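/- Let $U\subset\mathbb{R}^n$ be open and let $(x,y)$ denote points of $TU=U\times\mathbb{R}^n$. Write $J=dx^i\otimes\partial_{y^i}$, $\mathcal C=y^i\partial_{y^i}$, $S_0=y^i\partial_{x^i}$, $d_JL=\frac{\partial L}{\partial y^i}dx^i$, $d_{h_0}L=\frac{\partial L}{\partial x^i}dx^i$ and $\delta_{S_0}L=\{S_0(\frac{\partial L}{\partial y^i})-\frac{\partial L}{\partial x^i}\}dx^i$. A Finsler function on $U$ is a continuous $F:TU\to\mathbb{R}$, positively $1$-homogeneous in $y$, smooth and positive for $y\ne0$, whose metric tensor $g_{ij}=\frac12\frac{\partial^2F^2}{\partial y^i\partial y^j}$ has rank $n$ for $y\neq 0$. A geodesic spray of $F$ is a spray $S=y^i\partial_{x^i}-2G^i\partial_{y^i}$ ($G^i$ smooth and $2$-homogeneous for $y\neq0$) with $i_Sdd_JF^2=-dF^2$; it is unique if $F$ is a Finsler function. $F$ is projectively flat with projective factor $P$ if $S_0-2P\mathcal C$ is a geodesic spray of $F$, with $P$ smooth and $1$-homogeneous for $y\neq0$. $F$ has flag curvature $\kappa$ if the Jacobi endomorphism $\Phi=R^i_j\,\partial_{y^i}\otimes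 dx^j$ of its geodesic spray, $R^i_j=2\frac{\delta G^i}{\delta x^j}-S(N^i_j)+N^i_kN^k_j$ with $N^i_j=\frac{\partial G^i}{\partial y^j}$ and $\frac{\delta}{\delta x^j}=\frac{\partial}{\partial x^j}-N^k_j\frac{\partial}{\partial y^k}$, equals $\kappa F^2J-\kappa F\,d_JF\otimes\mathcal C$. (1) Let $F$, $\overline F$ be projectively flat Finsler functions on $U$, $g$ a smooth function on $U$, $f(x,y)=f_i(x)y^i$ with $f_i\,dx^i$ a smooth closed $1$-form on $U$, and suppose that $\widetilde F=g\overline F+\frac fF\overline F$ is a Finsler function on $U$. Then $\widetilde F$ is projectively flat if and only if, for all $x\in U$ and $y\neq0$, $$\overline Fd_{h_0}g-S_0g\,d_J\overline F-\frac{S_0f\,d_J\overline F}{F}+\frac{\overline FS_0f\,d_JF}{F^2}-\frac{S_0\overline F\,d_Jf}{F}+\frac{fS_0\overline F\,d_JF}{F^2}+\frac{\overline FS_0F\,d_Jf}{F^2}+\frac{fS_0F\,d_J\overline F}{F^2}-\frac{2f\overline FS_0F\,d_JF}{F^3}=0.$$ (2) Let $c,\eta,e\in\mathbb{R}$, $\eta>0$,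 $v\in\mathbb{R}^n$, and suppose $4c^2|x|^2<1$ for all $x\in U$. Put $r=\sqrt{|y|^2-4c^2(|x|^2|y|^2-\langle x,y\rangle^2)}$, $$F=\frac{r+2c\langle x,y\rangle}{1-4c^2|x|^2},\qquad \overline F=\frac{\eta\,(r+2c\langle x,y\rangle)^2}{(1-4c^2|x|^2)^2\,r},\qquad g=2c\langle v,x\rangle+e,\qquad f=\langle v,y\rangle,$$ with $\overline F(x,0)=0$, and let $\widetilde F=\left(g+\frac fF\right)\overline F$ for $y\neq 0$, $\widetilde F(x,0)=0$; that is, $$\widetilde F=\frac{\eta\,(r+2c\langle x,y\rangle)^2}{(1-4c^2|x|^2)^2\,r}\left(2c\langle v,x\rangle+e+\frac{\langle v,y\rangle}{\frac{r}{1-4c^2|x|^2}+\frac{2c\langle x,y\rangle}{1-4c^2|x|^2}}\right)\qquad(y\neq0).$$ Suppose that $\widetilde F>0$ for all $x\in U$, $y\neq0$. Then $\widetilde F$ is continuous, smooth for $y\neq0$ and positively $1$-homogeneous; $\delta_{S_0}\widetilde F=0$ for $y\neq 0$; $\widetilde F$ is projectively flat on $U$ with projective factor $P=\frac{S_0\widetilde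 F}{2\widetilde F}=2cF$, and $\delta_{S_0}P=0$, so that $P$ is a Hamel function of $S_0$; the Jacobi endomorphism of the geodesic spray $S_0-4cF\,\mathcal C$ vanishes for $y\neq0$, so $\widetilde F$ has zero flag curvature. At every $(x,y)$ with $y\neq 0$ at which the metric tensor of $\widetilde F$ has rank $n$, every geodesic spray of $\widetilde F$ agrees with $S_0-4cF\,\mathcal C$. -/

import Mathlib

open scoped ContDiff

noncomputable section

namespace FlatFinsler

/-! Finsler geometry on an open subset `U` of a real vector space `E`. Points of `TE = E × E` are
written `(x, y)`; the slit tangent bundle of `U` consists of the `(x, y)` with `x ∈ U`, `y ≠ 0`. -/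

section General

variable {E : Type*} [NormedAddCommGroup E] [NormedSpace ℝ E]
variable {W : Type*} [NormedAddCommGroup W] [NormedSpace ℝ W]

/-- The slit tangent bundle of `U`. -/
def slit (U : Set E) : Set (E × E) := {p | p.1 ∈ U ∧ p.2 ≠ 0}

/-- `∂L/∂x`. For scalar `L` this is the semi-basic 1-form `d_{h₀} L = (∂L/∂xⁱ) dxⁱ`, where `h₀` is
the horizontal projector of the flat spray. -/
def dX (L : E → E → W) (x y : E) : E →L[ℝ] W := fderiv ℝ (fun z => L z y) x

/-- `∂L/∂y`. For scalar `L` this is the semi-basic 1-form `d_J L = (∂L/∂yⁱ) dxⁱ`. -/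
def dJ (L : E → E → W) (x y : E) : E →L[ℝ] W := fderiv ℝ (fun z => L x z) y

/-- The semispray `S = yⁱ ∂/∂xⁱ - 2 Gⁱ(x,y) ∂/∂yⁱ` with coefficients `G`, at the point `(x, y)`. -/
def sprayField (G : E → E → E) (x y : E) : E × E := (y, -((2 : ℝ) • G x y))

/-- `S(L)`: the derivative of a function `L` on `TE` along the semispray with coefficients `G`. -/
def sprayDeriv (G : E → E → E) (L : E → E → W) (x y : E) : W :=
  fderiv ℝ (fun p : E × E => L p.1 p.2) (x, y) (sprayField G x y)

/-- The coefficients of the flat spray `S₀ = yⁱ ∂/∂xⁱ`. -/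
def flatSpray : E → E → E := fun _ _ => 0

/-- The coefficients of `S₀ - 2 P 𝒞`, where `𝒞 = yⁱ ∂/∂yⁱ` is the Liouville field. -/
def projSpray (P : E → E → ℝ) : E → E → E := fun x y => P x y • y

/-- The Euler-Lagrange 1-form `δ_S L = {S(∂L/∂yⁱ) - ∂L/∂xⁱ} dxⁱ`. -/
def eulerLagrange (G : E → E → E) (L : E → E → ℝ) (x y : E) : E →L[ℝ] ℝ :=
  sprayDeriv G (dJ L) x y - dX L x y

/-- A Hamel function of the semispray with coefficients `G`: a 1-homogeneous solution of
`δ_S P = 0` on the slit tangent bundle. -/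
def IsHamelOn (U : Set E) (G : E → E → E) (P : E → E → ℝ) : Prop :=
  (∀ x ∈ U, ∀ y : E, y ≠ 0 → ∀ r : ℝ, 0 < r → P x (r • y) = r * P x y) ∧
    ∀ x ∈ U, ∀ y : E, y ≠ 0 → eulerLagrange G P x y = 0

/-- The 1-form `d_J L` on `TE`. -/
def dJForm (L : E → E → ℝ) (p : E × E) : E × E →L[ℝ] ℝ :=
  (dJ L p.1 p.2).comp (ContinuousLinearMap.fst ℝ E E)

/-- The exterior derivative of a 1-form `α`, `dα(u, w) = (D_u α)(w) - (D_w α)(u)`. -/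
def dOneForm (α : W → W →L[ℝ] ℝ) (p u w : W) : ℝ := fderiv ℝ α p u w - fderiv ℝ α p w u

/-- The metric tensor `g_{(x,y)}(u, w) = (1/2) uⁱ wʲ ∂²F²/∂yⁱ∂yʲ`. -/
def metricTensor (F : E → E → ℝ) (x y u w : E) : ℝ :=
  (1 / 2) * fderiv ℝ (fun z => dJ (fun x y => F x y ^ 2) x z) y u w

/-- All requirements on a Finsler function on `U` except the regularity of the metric tensor. -/
structure IsPreFinslerOn (U : Set E) (F : E → E → ℝ) : Prop where
  continuousOn : ContinuousOn (fun p : E × E => F p.1 p.2) (U ×ˢ Set.univ)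
  smooth : ContDiffOn ℝ ∞ (fun p : E × E => F p.1 p.2) (slit U)
  pos : ∀ x ∈ U, ∀ y : E, y ≠ 0 → 0 < F x y
  homogeneous : ∀ x ∈ U, ∀ y : E, ∀ r : ℝ, 0 < r → F x (r • y) = r * F x y

/-- A Finsler function on `U`: the metric tensor is moreover nondegenerate on the slit tangent
bundle. -/
structure IsFinslerOn (U : Set E) (F : E → E → ℝ) : Prop extends IsPreFinslerOn U F where
  regular : ∀ x ∈ U, ∀ y : E, y ≠ 0 → ∀ u : E, (∀ w : E, metricTensor F x y u w = 0) → u = 0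

/-- The semispray with coefficients `G` is a spray on `U`: smooth on the slit tangent bundle, with
2-homogeneous coefficients. -/
structure IsSprayOn (U : Set E) (G : E → E → E) : Prop where
  smooth : ContDiffOn ℝ ∞ (fun p : E × E => G p.1 p.2) (slit U)
  homogeneous : ∀ x ∈ U, ∀ y : E, y ≠ 0 → ∀ r : ℝ, 0 < r → G x (r • y) = r ^ 2 • G x y

/-- `G` gives a geodesic spray of `F` on `U`: a spray `S` with `i_S d d_J F² = - d F²`. It is unique
when `F` is a Finsler function. -/
structure IsGeodesicSprayOn (U : Set E) (F : E → E → ℝ) (G : E → E → E) : Prop where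
  spray : IsSprayOn U G
  metrizes : ∀ x ∈ U, ∀ y : E, y ≠ 0 → ∀ w : E × E,
    dOneForm (dJForm fun x y => F x y ^ 2) (x, y) (sprayField G x y) w =
      -fderiv ℝ (fun p : E × E => F p.1 p.2 ^ 2) (x, y) w

/-- `F` is projectively flat on `U` with projective factor `P`: its geodesic spray is
`S = S₀ - 2 P 𝒞`, for a smooth 1-homogeneous function `P`. -/
structure IsProjectivelyFlatWith (U : Set E) (F P : E → E → ℝ) : Prop where
  smooth : ContDiffOn ℝ ∞ (fun p : E × E => P p.1 p.2) (slit U)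
  homogeneous : ∀ x ∈ U, ∀ y : E, y ≠ 0 → ∀ r : ℝ, 0 < r → P x (r • y) = r * P x y
  geodesic : IsGeodesicSprayOn U F (projSpray P)

/-- `F` is projectively flat on `U`. -/
def IsProjectivelyFlatOn (U : Set E) (F : E → E → ℝ) : Prop :=
  ∃ P : E → E → ℝ, IsProjectivelyFlatWith U F P

/-- The Jacobi endomorphism
`Rⁱⱼ = 2 δGⁱ/δxʲ - S(Nⁱⱼ) + Nⁱₖ Nᵏⱼ`, where `Nⁱⱼ = ∂Gⁱ/∂yʲ` and `δ/δxʲ = ∂/∂xʲ - Nᵏⱼ ∂/∂yᵏ`. -/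
def jacobiEndomorphism (G : E → E → E) (x y : E) : E →L[ℝ] E :=
  (2 : ℝ) • (dX G x y - (dJ G x y).comp (dJ G x y)) - sprayDeriv G (dJ G) x y
    + (dJ G x y).comp (dJ G x y)

/-- `F` is of scalar flag curvature `κ` on `U`: the Jacobi endomorphism of its geodesic spray is
`Φ = κ F² J - κ F d_J F ⊗ 𝒞`. -/
def HasFlagCurvatureOn (U : Set E) (F κ : E → E → ℝ) : Prop :=
  ∃ G : E → E → E, IsGeodesicSprayOn U F G ∧
    ∀ x ∈ U, ∀ y : E, y ≠ 0 → ∀ w : E,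
      jacobiEndomorphism G x y w =
        (κ x y * F x y ^ 2) • w - (κ x y * F x y * dJ F x y w) • y

/-- The deformation `g F̄ + (f / F) F̄` of `F̄`, where `g` is a function on the base and
`f(x, y) = fᵢ(x) yⁱ` a 1-form. -/
def deformation (F Fbar : E → E → ℝ) (g : E → ℝ) (f : E → E →L[ℝ] ℝ) : E → E → ℝ :=
  fun x y => g x * Fbar x y + f x y / F x y * Fbar x y

/-- The 1-form whose vanishing expresses that the deformation `g F̄ + (f / F) F̄` is projectively
flat, evaluated at the vector `w`. -/
def flatnessForm (F Fbar : E → E → ℝ) (g : E → ℝ) (f : E → E →L[ℝ] ℝ) (x y w : E) : ℝ :=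
  let S₀ : (E → E → ℝ) → ℝ := fun L => sprayDeriv flatSpray L x y
  let g' : E → E → ℝ := fun x _ => g x
  let f' : E → E → ℝ := fun x y => f x y
  Fbar x y * dX g' x y w
    - S₀ g' * dJ Fbar x y w
    - S₀ f' * dJ Fbar x y w / F x y
    + Fbar x y * S₀ f' * dJ F x y w / F x y ^ 2
    - S₀ Fbar * dJ f' x y w / F x y
    + f x y * S₀ Fbar * dJ F x y w / F x y ^ 2
    + Fbar x y * S₀ F * dJ f' x y w / F x y ^ 2
    + f x y * S₀ F * dJ Fbar x y w / F x y ^ 2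
    - 2 * f x y * Fbar x y * S₀ F * dJ F x y w / F x y ^ 3

end General

section Families

variable {E : Type*} [NormedAddCommGroup E] [InnerProductSpace ℝ E]

/-- `√(|y|² - 4c²(|x|²|y|² - ⟨x,y⟩²))`. -/
def root (c : ℝ) (x y : E) : ℝ :=
  Real.sqrt (‖y‖ ^ 2 - 4 * c ^ 2 * (‖x‖ ^ 2 * ‖y‖ ^ 2 - inner ℝ x y ^ 2))

/-- The Randers metric `F = a + b`, where `a = root c / (1 - 4c²|x|²)` and
`b = 2c⟨x,y⟩ / (1 - 4c²|x|²)`. -/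
def randers (c : ℝ) (x y : E) : ℝ :=
  root c x y / (1 - 4 * c ^ 2 * ‖x‖ ^ 2) + 2 * c * inner ℝ x y / (1 - 4 * c ^ 2 * ‖x‖ ^ 2)

/-- The family `F̄` of metrics of Berwald type. -/
def berwald (c η : ℝ) (x y : E) : ℝ :=
  η * (root c x y + 2 * c * inner ℝ x y) ^ 2 / ((1 - 4 * c ^ 2 * ‖x‖ ^ 2) ^ 2 * root c x y)

/-- The family `F̃ = (g + f / F) F̄`, `g = 2c⟨v,x⟩ + e`, `f = ⟨v,y⟩`. -/
def conformalFamily (c η e : ℝ) (v : E) : E → E → ℝ :=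
  deformation (randers c) (berwald c η) (fun x => 2 * c * inner ℝ v x + e)
    (fun _ => innerSL ℝ v)

end Families

end FlatFinsler

end

noncomputable section

namespace FlatFinsler

/-! Everything is reduced to the Euler-Lagrange form of the flat spray. By Rapcsák's criterion
(`eulerLagrange_projSpray_sq_eq_zero_iff`), `S₀ - 2P𝒞` is geodesic for `F` exactly when `δ_{S₀} F =
0` and `S₀F = 2PF`. The second equation can be solved for `P`, so projective flatness is the single
equation `δ_{S₀} F = 0`.

For the criterion, put `q = f/F`. The Leibniz rule `eulerLagrange_mul` expands `δ_{S₀}(gF̄ + qF̄)`.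
The only unknown left is `δ_{S₀} q`. Closedness of `f` gives `δ_{S₀}(qF) = δ_{S₀} f = 0`, which
determines it. The outcome is minus the stated 1-form.

For the explicit family, put `ξ = y + 2cFx`. The Randers metric satisfies the implicit equation
`|ξ|² = F²`, the root is `r = F - 2c⟨ξ,x⟩`, and `F̃ = ηF(⟨v,ξ⟩ + eF)/r`. Differentiating these
relations gives `d_{h₀}F = 2cF d_JF` and `d_{h₀}F̃ = 2c d_J(FF̃)`. Contracting the latter with `y`
gives `S₀F̃ = 4cFF̃`, hence `d_J(S₀F̃) = 2 d_{h₀}F̃`, which says `δ_{S₀}F̃ = 0`. Thus `P = 2cF`, and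
`d_{h₀}P = P d_JP` forces the Jacobi endomorphism of `S₀ - 2P𝒞` to vanish. -/

theorem isOpen_slit {E : Type*} [NormedAddCommGroup E] {U : Set E} (hU : IsOpen U) :
    IsOpen (slit U) :=
  (hU.preimage continuous_fst).inter (isOpen_compl_singleton.preimage continuous_snd)

/-! ### Calculus of `d_{h₀}`, `d_J`, sprays and the Euler-Lagrange form on an open subset of `E ×
E`. -/

section Calculus

variable {E : Type*} [NormedAddCommGroup E] [NormedSpace ℝ E]
variable {W : Type*} [NormedAddCommGroup W] [NormedSpace ℝ W]
variable {O : Set (E × E)} {L M : E → E → W} {x y : E}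

theorem dX_apply (hL : DifferentiableAt ℝ (fun p : E × E => L p.1 p.2) (x, y)) (w : E) :
    dX L x y w = fderiv ℝ (fun p : E × E => L p.1 p.2) (x, y) (w, 0) := by
  have h : HasFDerivAt (fun z => L z y) _ x :=
    hL.hasFDerivAt.comp (f := fun z => (z, y)) x (hasFDerivAt_prodMk_left x y)
  rw [dX, h.fderiv]
  simp

theorem dJ_eq (hL : DifferentiableAt ℝ (fun p : E × E => L p.1 p.2) (x, y)) :
    dJ L x y = (fderiv ℝ (fun p : E × E => L p.1 p.2) (x, y)).comp
      (ContinuousLinearMap.inr ℝ E E) :=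
  (hL.hasFDerivAt.comp (f := fun z => (x, z)) y (hasFDerivAt_prodMk_right x y)).fderiv

theorem dJ_apply (hL : DifferentiableAt ℝ (fun p : E × E => L p.1 p.2) (x, y)) (w : E) :
    dJ L x y w = fderiv ℝ (fun p : E × E => L p.1 p.2) (x, y) (0, w) := by
  rw [dJ_eq hL]
  simp

theorem fderiv_eq_dX_add_dJ (hL : DifferentiableAt ℝ (fun p : E × E => L p.1 p.2) (x, y))
    (w : E × E) :
    fderiv ℝ (fun p : E × E => L p.1 p.2) (x, y) w = dX L x y w.1 + dJ L x y w.2 := by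
  rw [dX_apply hL, dJ_apply hL, ← map_add]
  simp

theorem sprayDeriv_flat (L : E → E → W) (x y : E) :
    sprayDeriv flatSpray L x y = fderiv ℝ (fun p : E × E => L p.1 p.2) (x, y) (y, 0) := by
  simp [sprayDeriv, sprayField, flatSpray]

theorem sprayDeriv_flat_eq_dX (hL : DifferentiableAt ℝ (fun p : E × E => L p.1 p.2) (x, y)) :
    sprayDeriv flatSpray L x y = dX L x y y := by
  rw [sprayDeriv_flat, dX_apply hL]

theorem sprayDeriv_eq (G : E → E → E)
    (hL : DifferentiableAt ℝ (fun p : E × E => L p.1 p.2) (x, y)) :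
    sprayDeriv G L x y = sprayDeriv flatSpray L x y - (2 : ℝ) • dJ L x y (G x y) := by
  rw [sprayDeriv_flat_eq_dX hL, sprayDeriv, fderiv_eq_dX_add_dJ hL]
  simp [sprayField, sub_eq_add_neg]

theorem differentiableAt_of_smoothOn (hO : IsOpen O)
    (hL : ContDiffOn ℝ ∞ (fun p : E × E => L p.1 p.2) O) (h : (x, y) ∈ O) :
    DifferentiableAt ℝ (fun p : E × E => L p.1 p.2) (x, y) :=
  (hL.contDiffAt (hO.mem_nhds h)).differentiableAt (by simp)

theorem smoothOn_fderiv (hO : IsOpen O)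
    (hL : ContDiffOn ℝ ∞ (fun p : E × E => L p.1 p.2) O) :
    ContDiffOn ℝ ∞ (fderiv ℝ (fun p : E × E => L p.1 p.2)) O :=
  hL.fderiv_of_isOpen hO (by simp)

theorem smoothOn_dJ (hO : IsOpen O)
    (hL : ContDiffOn ℝ ∞ (fun p : E × E => L p.1 p.2) O) :
    ContDiffOn ℝ ∞ (fun p : E × E => dJ L p.1 p.2) O :=
  ((smoothOn_fderiv hO hL).clm_comp contDiffOn_const).congr fun _ hp =>
    dJ_eq (differentiableAt_of_smoothOn hO hL hp)

theorem smoothOn_sprayDeriv_flat (hO : IsOpen O)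
    (hL : ContDiffOn ℝ ∞ (fun p : E × E => L p.1 p.2) O) :
    ContDiffOn ℝ ∞ (fun p : E × E => sprayDeriv flatSpray L p.1 p.2) O :=
  ((smoothOn_fderiv hO hL).clm_apply
    (contDiffOn_snd.prodMk contDiffOn_const)).congr fun p _ => sprayDeriv_flat L p.1 p.2

theorem fderiv_congr_on (hO : IsOpen O) (h : (x, y) ∈ O)
    (hLM : ∀ p ∈ O, L p.1 p.2 = M p.1 p.2) :
    fderiv ℝ (fun p : E × E => L p.1 p.2) (x, y) = fderiv ℝ (fun p : E × E => M p.1 p.2) (x, y) :=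
  Filter.EventuallyEq.fderiv_eq (Filter.eventually_of_mem (hO.mem_nhds h) hLM)

theorem dX_congr_on (hO : IsOpen O) (h : (x, y) ∈ O) (hLM : ∀ p ∈ O, L p.1 p.2 = M p.1 p.2) :
    dX L x y = dX M x y :=
  Filter.EventuallyEq.fderiv_eq <| Filter.mem_of_superset
    ((hO.preimage (Continuous.prodMk_left y)).mem_nhds h) fun z hz => hLM (z, y) hz

theorem dJ_congr_on (hO : IsOpen O) (h : (x, y) ∈ O) (hLM : ∀ p ∈ O, L p.1 p.2 = M p.1 p.2) :
    dJ L x y = dJ M x y :=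
  Filter.EventuallyEq.fderiv_eq <| Filter.mem_of_superset
    ((hO.preimage (Continuous.prodMk_right x)).mem_nhds h) fun z hz => hLM (x, z) hz

theorem sprayDeriv_congr_on (G : E → E → E) (hO : IsOpen O) (h : (x, y) ∈ O)
    (hLM : ∀ p ∈ O, L p.1 p.2 = M p.1 p.2) : sprayDeriv G L x y = sprayDeriv G M x y := by
  rw [sprayDeriv, sprayDeriv, fderiv_congr_on hO h hLM]

theorem eulerLagrange_congr_on (G : E → E → E) {L M : E → E → ℝ} (hO : IsOpen O)
    (h : (x, y) ∈ O) (hLM : ∀ p ∈ O, L p.1 p.2 = M p.1 p.2) :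
    eulerLagrange G L x y = eulerLagrange G M x y := by
  rw [eulerLagrange, eulerLagrange, dX_congr_on hO h hLM,
    sprayDeriv_congr_on G hO h fun p hp => dJ_congr_on hO hp hLM]

/-- Euler's identity. -/
theorem fderiv_self_of_homogeneous {L : E → W} (k : ℕ) (hL : DifferentiableAt ℝ L y)
    (hom : ∀ r : ℝ, 0 < r → L (r • y) = r ^ k • L y) : fderiv ℝ L y y = (k : ℝ) • L y := by
  have h1 : HasDerivAt (fun r : ℝ => L (r • y)) (fderiv ℝ L y y) 1 := by
    have hy : HasDerivAt (fun r : ℝ => r • y) y 1 := by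
      simpa using (hasDerivAt_id (1 : ℝ)).smul_const y
    have hL' : HasFDerivAt L (fderiv ℝ L y) ((1 : ℝ) • y) := by simpa using hL.hasFDerivAt
    exact hL'.comp_hasDerivAt (1 : ℝ) hy
  have h2 : HasDerivAt (fun r : ℝ => r ^ k • L y) ((k : ℝ) • L y) 1 := by
    simpa using (hasDerivAt_pow k (1 : ℝ)).smul_const (L y)
  refine h1.unique (h2.congr_of_eventuallyEq ?_)
  filter_upwards [lt_mem_nhds one_pos] with r hr using hom r hr

/-- Differentiate `L(rz) = r^(k+1) L(z)` in `z` and cancel one factor `r`. Writing the degree as `k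
+ 1` avoids subtraction in `ℕ`. -/
theorem fderiv_smul_of_homogeneous {L : E → W} (k : ℕ) (hy : y ≠ 0)
    (hom : ∀ z : E, z ≠ 0 → ∀ r : ℝ, 0 < r → L (r • z) = r ^ (k + 1) • L z) {r : ℝ}
    (hr : 0 < r) : fderiv ℝ L (r • y) = r ^ k • fderiv ℝ L y := by
  have h1 : fderiv ℝ (fun z => L (r • z)) y = r • fderiv ℝ L (r • y) :=
    fderiv_comp_smul r
  have h2 : fderiv ℝ (fun z => L (r • z)) y = fderiv ℝ (fun z => r ^ (k + 1) • L z) y := by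
    refine Filter.EventuallyEq.fderiv_eq ?_
    filter_upwards [isOpen_compl_singleton.mem_nhds hy] with z hz using hom z hz r hr
  have h4 : fderiv ℝ (fun z => r ^ (k + 1) • L z) y = r ^ (k + 1) • fderiv ℝ L y :=
    congrFun (fderiv_const_smul_field (f := L) (r ^ (k + 1))) y
  rw [h2, h4] at h1
  have h3 : r • (r ^ k • fderiv ℝ L y) = r • fderiv ℝ L (r • y) := by
    rw [← h1, smul_smul, pow_succ']
  exact (smul_right_injective _ hr.ne' h3).symm

section Mul

variable {A B : E → E → ℝ}

theorem dX_mul (hA : DifferentiableAt ℝ (fun p : E × E => A p.1 p.2) (x, y))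
    (hB : DifferentiableAt ℝ (fun p : E × E => B p.1 p.2) (x, y)) :
    dX (fun x y => A x y * B x y) x y = A x y • dX B x y + B x y • dX A x y :=
  fderiv_fun_mul (hA.comp (f := fun z => (z, y)) x (by fun_prop))
    (hB.comp (f := fun z => (z, y)) x (by fun_prop))

theorem dJ_mul (hA : DifferentiableAt ℝ (fun p : E × E => A p.1 p.2) (x, y))
    (hB : DifferentiableAt ℝ (fun p : E × E => B p.1 p.2) (x, y)) :
    dJ (fun x y => A x y * B x y) x y = A x y • dJ B x y + B x y • dJ A x y :=
  fderiv_fun_mul (hA.comp (f := fun z => (x, z)) y (by fun_prop))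
    (hB.comp (f := fun z => (x, z)) y (by fun_prop))

theorem sprayDeriv_mul (G : E → E → E)
    (hA : DifferentiableAt ℝ (fun p : E × E => A p.1 p.2) (x, y))
    (hB : DifferentiableAt ℝ (fun p : E × E => B p.1 p.2) (x, y)) :
    sprayDeriv G (fun x y => A x y * B x y) x y =
      A x y * sprayDeriv G B x y + B x y * sprayDeriv G A x y := by
  simp only [sprayDeriv]
  rw [fderiv_fun_mul hA hB]
  simp

theorem sprayDeriv_smul (G : E → E → E)
    (hA : DifferentiableAt ℝ (fun p : E × E => A p.1 p.2) (x, y))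
    (hL : DifferentiableAt ℝ (fun p : E × E => L p.1 p.2) (x, y)) :
    sprayDeriv G (fun x y => A x y • L x y) x y =
      A x y • sprayDeriv G L x y + sprayDeriv G A x y • L x y := by
  simp only [sprayDeriv]
  rw [fderiv_fun_smul hA hL]
  simp

theorem sprayDeriv_add (G : E → E → E)
    (hL : DifferentiableAt ℝ (fun p : E × E => L p.1 p.2) (x, y))
    (hM : DifferentiableAt ℝ (fun p : E × E => M p.1 p.2) (x, y)) :
    sprayDeriv G (fun x y => L x y + M x y) x y = sprayDeriv G L x y + sprayDeriv G M x y := by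
  simp only [sprayDeriv]
  rw [fderiv_fun_add hL hM]
  simp

/-- `δ_S` is of second order, so the product rule leaves two cross terms, each pairing `S` of one
factor with `d_J` of the other. They account for nearly all terms of `flatnessForm`. -/
theorem eulerLagrange_mul (G : E → E → E) (hO : IsOpen O)
    (hA : ContDiffOn ℝ ∞ (fun p : E × E => A p.1 p.2) O)
    (hB : ContDiffOn ℝ ∞ (fun p : E × E => B p.1 p.2) O) (h : (x, y) ∈ O) :
    eulerLagrange G (fun x y => A x y * B x y) x y =
      A x y • eulerLagrange G B x y + B x y • eulerLagrange G A x y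
        + sprayDeriv G A x y • dJ B x y + sprayDeriv G B x y • dJ A x y := by
  have dA := differentiableAt_of_smoothOn hO hA h
  have dB := differentiableAt_of_smoothOn hO hB h
  have dJA := differentiableAt_of_smoothOn hO (smoothOn_dJ hO hA) h
  have dJB := differentiableAt_of_smoothOn hO (smoothOn_dJ hO hB) h
  have key : sprayDeriv G (dJ fun x y => A x y * B x y) x y =
      sprayDeriv G (fun x y => A x y • dJ B x y + B x y • dJ A x y) x y :=
    sprayDeriv_congr_on G hO h fun p hp => dJ_mul (differentiableAt_of_smoothOn hO hA hp)
      (differentiableAt_of_smoothOn hO hB hp)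
  rw [eulerLagrange, key, sprayDeriv_add G (dA.smul dJB) (dB.smul dJA), sprayDeriv_smul G dA dJB,
    sprayDeriv_smul G dB dJA, dX_mul dA dB, eulerLagrange, eulerLagrange]
  module

theorem eulerLagrange_add (G : E → E → E) (hO : IsOpen O)
    (hA : ContDiffOn ℝ ∞ (fun p : E × E => A p.1 p.2) O)
    (hB : ContDiffOn ℝ ∞ (fun p : E × E => B p.1 p.2) O) (h : (x, y) ∈ O) :
    eulerLagrange G (fun x y => A x y + B x y) x y =
      eulerLagrange G A x y + eulerLagrange G B x y := by
  have dA := differentiableAt_of_smoothOn hO hA h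
  have dB := differentiableAt_of_smoothOn hO hB h
  have key : sprayDeriv G (dJ fun x y => A x y + B x y) x y =
      sprayDeriv G (fun x y => dJ A x y + dJ B x y) x y :=
    sprayDeriv_congr_on G hO h fun p hp =>
      fderiv_fun_add ((differentiableAt_of_smoothOn hO hA hp).comp (f := fun z => (p.1, z)) p.2
        (by fun_prop)) ((differentiableAt_of_smoothOn hO hB hp).comp (f := fun z => (p.1, z)) p.2
        (by fun_prop))
  have hX : dX (fun x y => A x y + B x y) x y = dX A x y + dX B x y :=
    fderiv_fun_add (dA.comp (f := fun z => (z, y)) x (by fun_prop))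
      (dB.comp (f := fun z => (z, y)) x (by fun_prop))
  rw [eulerLagrange, key, hX, sprayDeriv_add G
    (differentiableAt_of_smoothOn hO (smoothOn_dJ hO hA) h)
    (differentiableAt_of_smoothOn hO (smoothOn_dJ hO hB) h), eulerLagrange, eulerLagrange]
  abel

end Mul

/-- `δ_{S₀} L = d_J (S₀ L) - 2 d_{h₀} L`. -/
theorem eulerLagrange_flat_eq {L : E → E → ℝ} (hO : IsOpen O)
    (hL : ContDiffOn ℝ ∞ (fun p : E × E => L p.1 p.2) O) (h : (x, y) ∈ O) :
    eulerLagrange flatSpray L x y =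
      dJ (sprayDeriv flatSpray L) x y - (2 : ℝ) • dX L x y := by
  have dL := differentiableAt_of_smoothOn hO hL h
  have ddL : DifferentiableAt ℝ (fderiv ℝ (fun p : E × E => L p.1 p.2)) (x, y) :=
    ((smoothOn_fderiv hO hL).contDiffAt (hO.mem_nhds h)).differentiableAt (by simp)
  have hsymm := (hL.contDiffAt (hO.mem_nhds h)).isSymmSndFDerivAt
    (by simpa using WithTop.coe_le_coe.2 (le_top : (2 : ℕ∞) ≤ ⊤))
  ext w
  have h1 : sprayDeriv flatSpray (dJ L) x y w =
      fderiv ℝ (fderiv ℝ (fun p : E × E => L p.1 p.2)) (x, y) (y, 0) (0, w) := by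
    rw [sprayDeriv_flat, fderiv_congr_on hO h (M := fun x y =>
      (fderiv ℝ (fun p : E × E => L p.1 p.2) (x, y)).comp (ContinuousLinearMap.inr ℝ E E))
      fun p hp => dJ_eq (differentiableAt_of_smoothOn hO hL hp)]
    rw [fderiv_clm_comp (c := fderiv ℝ (fun p : E × E => L p.1 p.2)) ddL
      (differentiableAt_const _)]
    simp
  -- The direction `(y, 0)` of `S₀` itself varies with `y`; this produces the extra `dX L`. The
  -- second-order terms of `h1` and `h2` agree by symmetry of the second derivative.
  have h2 : dJ (sprayDeriv flatSpray L) x y w =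
      fderiv ℝ (fderiv ℝ (fun p : E × E => L p.1 p.2)) (x, y) (0, w) (y, 0) + dX L x y w := by
    rw [dJ_apply (differentiableAt_of_smoothOn hO (smoothOn_sprayDeriv_flat hO hL) h),
      dX_apply dL, fderiv_congr_on hO h (M := fun x y =>
      fderiv ℝ (fun p : E × E => L p.1 p.2) (x, y) (y, 0)) fun p _ => sprayDeriv_flat L p.1 p.2]
    have hd : HasFDerivAt (fun p : E × E => ((p.2, 0) : E × E))
        ((ContinuousLinearMap.inl ℝ E E).comp (ContinuousLinearMap.snd ℝ E E)) (x, y) :=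
      ((ContinuousLinearMap.inl ℝ E E).comp (ContinuousLinearMap.snd ℝ E E)).hasFDerivAt
    have := (ddL.hasFDerivAt.clm_apply hd).fderiv
    simp only [Prod.mk.eta] at this ⊢
    rw [this]
    simp [add_comm]
  simp only [eulerLagrange, sub_apply, smul_apply, h1, h2,
    hsymm.eq (y, 0) (0, w), smul_eq_mul]
  ring

end Calculus

/-! ### Geodesic sprays, Rapcsák's criterion, uniqueness and the Jacobi endomorphism. -/

section Geodesic

variable {E : Type*} [NormedAddCommGroup E] [NormedSpace ℝ E]
variable {U : Set E} {F : E → E → ℝ} {G : E → E → E} {x y : E}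

theorem differentiableAt_snd_slice {W : Type*} [NormedAddCommGroup W] [NormedSpace ℝ W]
    {L : E → E → W} (hL : DifferentiableAt ℝ (fun p : E × E => L p.1 p.2) (x, y)) :
    DifferentiableAt ℝ (L x) y :=
  hL.comp (f := fun z => (x, z)) y (by fun_prop)

theorem dJ_self_of_homogeneous {L : E → E → ℝ} (k : ℕ)
    (hL : DifferentiableAt ℝ (fun p : E × E => L p.1 p.2) (x, y))
    (hom : ∀ r : ℝ, 0 < r → L x (r • y) = r ^ k * L x y) : dJ L x y y = k * L x y :=
  fderiv_self_of_homogeneous k (differentiableAt_snd_slice hL) hom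

/-- For a 2-homogeneous `L` the geodesic equation `i_S d d_J L = - dL` is the Euler-Lagrange
equation `δ_S L = 0`. -/
theorem dOneForm_dJForm_eq_iff (hU : IsOpen U) {L : E → E → ℝ}
    (hL : ContDiffOn ℝ ∞ (fun p : E × E => L p.1 p.2) (slit U))
    (hom : ∀ x ∈ U, ∀ y : E, y ≠ 0 → ∀ r : ℝ, 0 < r → L x (r • y) = r ^ 2 * L x y)
    (hx : x ∈ U) (hy : y ≠ 0) :
    (∀ w : E × E, dOneForm (dJForm L) (x, y) (sprayField G x y) w =
      -fderiv ℝ (fun p : E × E => L p.1 p.2) (x, y) w) ↔ eulerLagrange G L x y = 0 := by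
  have hO := isOpen_slit hU
  have h : (x, y) ∈ slit U := ⟨hx, hy⟩
  have dL := differentiableAt_of_smoothOn hO hL h
  have dA := differentiableAt_of_smoothOn hO (smoothOn_dJ hO hL) h
  have hform : ∀ u w : E × E, fderiv ℝ (dJForm L) (x, y) u w =
      fderiv ℝ (fun p : E × E => dJ L p.1 p.2) (x, y) u w.1 := by
    intro u w
    have := (dA.hasFDerivAt.clm_comp
      (hasFDerivAt_const (ContinuousLinearMap.fst ℝ E E) (x, y))).fderiv
    change fderiv ℝ (fun p : E × E => (dJ L p.1 p.2).comp (ContinuousLinearMap.fst ℝ E E)) _ u w = _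
    rw [this]
    simp
  -- Euler's identity `d_J L(y) = 2L`, differentiated in the direction `w`.
  have hE : ∀ w : E × E, fderiv ℝ (fun p : E × E => dJ L p.1 p.2) (x, y) w y + dJ L x y w.2 =
      2 * fderiv ℝ (fun p : E × E => L p.1 p.2) (x, y) w := by
    intro w
    have h1 := fderiv_congr_on (L := fun x y => dJ L x y y) (M := fun x y => 2 * L x y) hO h
      fun p hp => by
        simpa using dJ_self_of_homogeneous 2 (differentiableAt_of_smoothOn hO hL hp)
          (hom p.1 hp.1 p.2 hp.2)
    rw [(dA.hasFDerivAt.clm_apply hasFDerivAt_snd).fderiv, fderiv_const_mul dL] at h1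
    have := congrArg (fun T => T w) h1
    simp only [add_apply, smul_apply, ContinuousLinearMap.comp_apply,
      ContinuousLinearMap.flip_apply, ContinuousLinearMap.coe_snd', smul_eq_mul] at this
    linarith
  -- `hE` replaces `(D_w d_J L)(y)` by `2 dL(w) - d_J L(w.2)`. The vertical parts then cancel and
  -- `i_S d d_J L + dL` is semi-basic, equal to `δ_S L`.
  have key : ∀ w : E × E, dOneForm (dJForm L) (x, y) (sprayField G x y) w +
      fderiv ℝ (fun p : E × E => L p.1 p.2) (x, y) w = eulerLagrange G L x y w.1 := by
    intro w
    have h1 := hE w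
    have h2 := fderiv_eq_dX_add_dJ dL w
    rw [dOneForm, hform, hform, eulerLagrange, sub_apply, sprayDeriv]
    simp only [sprayField] at *
    linarith
  constructor
  · intro H
    ext w
    have := key (w, 0)
    rw [H] at this
    simpa using this.symm
  · intro H w
    have := key w
    rw [H] at this
    simp only [zero_apply] at this
    linarith

theorem IsPreFinslerOn.smooth_sq (hF : IsPreFinslerOn U F) :
    ContDiffOn ℝ ∞ (fun p : E × E => F p.1 p.2 ^ 2) (slit U) := hF.smooth.pow 2

theorem IsPreFinslerOn.homogeneous_sq (hF : IsPreFinslerOn U F) (x : E) (hx : x ∈ U) (y : E)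
    (_ : y ≠ 0) (r : ℝ) (hr : 0 < r) : F x (r • y) ^ 2 = r ^ 2 * F x y ^ 2 := by
  rw [hF.homogeneous x hx y r hr, mul_pow]

theorem IsPreFinslerOn.metrizes_iff (hU : IsOpen U) (hF : IsPreFinslerOn U F) (hx : x ∈ U)
    (hy : y ≠ 0) :
    (∀ w : E × E, dOneForm (dJForm fun x y => F x y ^ 2) (x, y) (sprayField G x y) w =
      -fderiv ℝ (fun p : E × E => F p.1 p.2 ^ 2) (x, y) w) ↔
        eulerLagrange G (fun x y => F x y ^ 2) x y = 0 :=
  dOneForm_dJForm_eq_iff (L := fun x y => F x y ^ 2) hU hF.smooth_sq hF.homogeneous_sq hx hy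

theorem eulerLagrange_eq_sub (hU : IsOpen U) {L : E → E → ℝ}
    (hL : ContDiffOn ℝ ∞ (fun p : E × E => L p.1 p.2) (slit U)) (G : E → E → E)
    (hx : x ∈ U) (hy : y ≠ 0) :
    eulerLagrange G L x y = eulerLagrange flatSpray L x y - (2 : ℝ) • dJ (dJ L) x y (G x y) := by
  have hO := isOpen_slit hU
  rw [eulerLagrange, eulerLagrange, sprayDeriv_eq G
    (differentiableAt_of_smoothOn hO (smoothOn_dJ hO hL) ⟨hx, hy⟩)]
  abel

/-- `d_J F²` is 1-homogeneous, so this is Euler's identity in degree one. It turns the vertical part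
of `S₀ - 2P𝒞` into a multiple of `d_J F²`. -/
theorem dJ_dJ_sq_self (hU : IsOpen U) (hF : IsPreFinslerOn U F) (hx : x ∈ U) (hy : y ≠ 0) :
    dJ (dJ fun x y => F x y ^ 2) x y y = dJ (fun x y => F x y ^ 2) x y := by
  have hO := isOpen_slit hU
  have := fderiv_self_of_homogeneous (L := dJ (fun x y => F x y ^ 2) x) (y := y) 1
    (differentiableAt_snd_slice (differentiableAt_of_smoothOn hO
      (smoothOn_dJ (L := fun x y => F x y ^ 2) hO hF.smooth_sq) ⟨hx, hy⟩))
    fun r hr => fderiv_smul_of_homogeneous 1 hy (hF.homogeneous_sq x hx) hr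
  rwa [Nat.cast_one, one_smul] at this

theorem dJ_self (hU : IsOpen U) (hF : IsPreFinslerOn U F) (hx : x ∈ U) (hy : y ≠ 0) :
    dJ F x y y = F x y := by
  simpa using dJ_self_of_homogeneous 1
    (differentiableAt_of_smoothOn (isOpen_slit hU) hF.smooth ⟨hx, hy⟩)
    fun r hr => by simpa using hF.homogeneous x hx y r hr

/-- Differentiate `d_J F(y) = F` along `S₀`, which leaves `y` fixed: `S₀(d_J F)(y) = S₀F =
d_{h₀}F(y)`. -/
theorem eulerLagrange_flat_self (hU : IsOpen U) (hF : IsPreFinslerOn U F) (hx : x ∈ U)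
    (hy : y ≠ 0) : eulerLagrange flatSpray F x y y = 0 := by
  have hO := isOpen_slit hU
  have h : (x, y) ∈ slit U := ⟨hx, hy⟩
  have dF := differentiableAt_of_smoothOn hO hF.smooth h
  have dA := differentiableAt_of_smoothOn hO (smoothOn_dJ hO hF.smooth) h
  have h1 := fderiv_congr_on (L := fun x y => dJ F x y y) (M := F) hO h
    fun p hp => dJ_self hU hF hp.1 hp.2
  rw [(dA.hasFDerivAt.clm_apply hasFDerivAt_snd).fderiv] at h1
  have := congrArg (fun T => T (y, 0)) h1
  simp only [add_apply, ContinuousLinearMap.comp_apply,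
    ContinuousLinearMap.flip_apply, ContinuousLinearMap.coe_snd', map_zero, zero_add] at this
  rw [eulerLagrange, sub_apply, sprayDeriv_flat, dX_apply dF, this, sub_self]

theorem eulerLagrange_projSpray_sq (hU : IsOpen U) (hF : IsPreFinslerOn U F) (P : E → E → ℝ)
    (hx : x ∈ U) (hy : y ≠ 0) :
    eulerLagrange (projSpray P) (fun x y => F x y ^ 2) x y =
      (2 * F x y) • eulerLagrange flatSpray F x y +
        (2 * (sprayDeriv flatSpray F x y - 2 * P x y * F x y)) • dJ F x y := by
  have hO := isOpen_slit hU
  have h : (x, y) ∈ slit U := ⟨hx, hy⟩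
  have dF := differentiableAt_of_smoothOn hO hF.smooth h
  rw [eulerLagrange_eq_sub (L := fun x y => F x y ^ 2) hU hF.smooth_sq _ hx hy, projSpray, map_smul,
    dJ_dJ_sq_self hU hF hx hy]
  simp only [pow_two]
  rw [eulerLagrange_mul flatSpray hO hF.smooth hF.smooth h, dJ_mul dF dF]
  module

/-- Rapcsák's criterion. -/
theorem eulerLagrange_projSpray_sq_eq_zero_iff (hU : IsOpen U) (hF : IsPreFinslerOn U F)
    (P : E → E → ℝ) (hx : x ∈ U) (hy : y ≠ 0) :
    eulerLagrange (projSpray P) (fun x y => F x y ^ 2) x y = 0 ↔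
      eulerLagrange flatSpray F x y = 0 ∧ sprayDeriv flatSpray F x y = 2 * P x y * F x y := by
  have hpos := hF.pos x hx y hy
  rw [eulerLagrange_projSpray_sq hU hF P hx hy]
  constructor
  · intro H
    -- Contraction with `y` kills `δ_{S₀}F` and sends `d_J F` to `F > 0`, so the coefficient of `d_J
    -- F` must vanish separately.
    have h1 := congrArg (fun T => T y) H
    simp only [add_apply, smul_apply, eulerLagrange_flat_self hU hF hx hy, dJ_self hU hF hx hy,
      smul_eq_mul, mul_zero, zero_add, zero_apply, mul_eq_zero, hpos.ne', or_false,
      OfNat.ofNat_ne_zero, false_or] at h1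
    rw [h1, mul_zero, zero_smul, add_zero, smul_eq_zero] at H
    exact ⟨H.resolve_left (by positivity), by linarith⟩
  · rintro ⟨h1, h2⟩
    rw [h1, h2]
    simp

theorem isSprayOn_projSpray {P : E → E → ℝ}
    (hP : ContDiffOn ℝ ∞ (fun p : E × E => P p.1 p.2) (slit U))
    (hom : ∀ x ∈ U, ∀ y : E, y ≠ 0 → ∀ r : ℝ, 0 < r → P x (r • y) = r * P x y) :
    IsSprayOn U (projSpray P) where
  smooth := hP.smul contDiffOn_snd
  homogeneous x hx y hy r hr := by
    rw [projSpray, projSpray, hom x hx y hy r hr, smul_smul, smul_smul]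
    congr 1
    ring

theorem IsPreFinslerOn.isProjectivelyFlatWith_iff (hU : IsOpen U) (hF : IsPreFinslerOn U F)
    {P : E → E → ℝ} (hP : ContDiffOn ℝ ∞ (fun p : E × E => P p.1 p.2) (slit U))
    (hom : ∀ x ∈ U, ∀ y : E, y ≠ 0 → ∀ r : ℝ, 0 < r → P x (r • y) = r * P x y) :
    IsProjectivelyFlatWith U F P ↔ ∀ x ∈ U, ∀ y : E, y ≠ 0 →
      eulerLagrange flatSpray F x y = 0 ∧ sprayDeriv flatSpray F x y = 2 * P x y * F x y := by
  constructor
  · intro H x hx y hy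
    rw [← eulerLagrange_projSpray_sq_eq_zero_iff hU hF P hx hy, ← hF.metrizes_iff hU hx hy]
    exact H.geodesic.metrizes x hx y hy
  · refine fun H => ⟨hP, hom, isSprayOn_projSpray hP hom, fun x hx y hy => ?_⟩
    rw [hF.metrizes_iff hU hx hy, eulerLagrange_projSpray_sq_eq_zero_iff hU hF P hx hy]
    exact H x hx y hy

/-- One factor `r` comes from `d_{h₀}F` and one from the direction `y`. This makes the projective
factor `S₀F/(2F)` 1-homogeneous. -/
theorem IsPreFinslerOn.sprayDeriv_flat_smul (hU : IsOpen U) (hF : IsPreFinslerOn U F) (hx : x ∈ U)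
    (hy : y ≠ 0) {r : ℝ} (hr : 0 < r) :
    sprayDeriv flatSpray F x (r • y) = r ^ 2 * sprayDeriv flatSpray F x y := by
  have hO := isOpen_slit hU
  have dF : ∀ z : E, z ≠ 0 → DifferentiableAt ℝ (fun p : E × E => F p.1 p.2) (x, z) :=
    fun z hz => differentiableAt_of_smoothOn hO hF.smooth ⟨hx, hz⟩
  have hry : r • y ≠ 0 := smul_ne_zero hr.ne' hy
  have h1 : dX F x (r • y) = r • dX F x y := by
    have : dX F x (r • y) = fderiv ℝ (fun z => r * F z y) x :=
      Filter.EventuallyEq.fderiv_eq <| by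
        filter_upwards [hU.mem_nhds hx] with z hz using hF.homogeneous z hz y r hr
    rw [this]
    exact fderiv_const_mul ((dF y hy).comp (f := fun z => (z, y)) x (by fun_prop)) r
  rw [sprayDeriv_flat_eq_dX (dF _ hry), sprayDeriv_flat_eq_dX (dF _ hy), h1]
  simp only [smul_apply, map_smul, smul_eq_mul]
  ring

theorem IsPreFinslerOn.isProjectivelyFlatOn_iff (hU : IsOpen U) (hF : IsPreFinslerOn U F) :
    IsProjectivelyFlatOn U F ↔ ∀ x ∈ U, ∀ y : E, y ≠ 0 → eulerLagrange flatSpray F x y = 0 := by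
  have hO := isOpen_slit hU
  constructor
  · rintro ⟨P, hP⟩ x hx y hy
    exact (((hF.isProjectivelyFlatWith_iff hU hP.smooth hP.homogeneous).1 hP) x hx y hy).1
  · intro H
    refine ⟨fun x y => sprayDeriv flatSpray F x y / (2 * F x y),
      (hF.isProjectivelyFlatWith_iff hU ?_ ?_).2 fun x hx y hy => ⟨H x hx y hy, ?_⟩⟩
    · exact (smoothOn_sprayDeriv_flat hO hF.smooth).div (contDiffOn_const.mul hF.smooth)
        fun p hp => (mul_pos two_pos (hF.pos p.1 hp.1 p.2 hp.2)).ne'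
    · intro x hx y hy r hr
      have := (hF.pos x hx y hy).ne'
      simp only [hF.sprayDeriv_flat_smul hU hx hy hr, hF.homogeneous x hx y r hr]
      field_simp
    · have := (hF.pos x hx y hy).ne'
      field_simp

/-- Both sprays solve `δ_{S₀}F² = 2 (d_J d_J F²)(G)`, which is linear in `G`, so their difference
lies in the kernel of the metric tensor. -/
theorem IsPreFinslerOn.eq_of_isGeodesicSprayOn (hU : IsOpen U) (hF : IsPreFinslerOn U F)
    {G' : E → E → E} (hG : IsGeodesicSprayOn U F G) (hG' : IsGeodesicSprayOn U F G')
    (hx : x ∈ U) (hy : y ≠ 0) (hreg : ∀ u, (∀ w, metricTensor F x y u w = 0) → u = 0) :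
    G x y = G' x y := by
  have h1 := (hF.metrizes_iff hU hx hy).1 (hG.metrizes x hx y hy)
  have h2 := (hF.metrizes_iff hU hx hy).1 (hG'.metrizes x hx y hy)
  rw [eulerLagrange_eq_sub (L := fun x y => F x y ^ 2) hU hF.smooth_sq _ hx hy] at h1 h2
  refine sub_eq_zero.1 (hreg _ fun w => ?_)
  have h3 : dJ (dJ fun x y => F x y ^ 2) x y (G x y - G' x y) = 0 := by
    have h4 := (sub_eq_zero.1 h1).symm.trans (sub_eq_zero.1 h2)
    rw [map_sub, sub_eq_zero]
    exact smul_right_injective _ (two_ne_zero (α := ℝ)) h4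
  have h5 : metricTensor F x y (G x y - G' x y) w =
    1 / 2 * dJ (dJ fun x y => F x y ^ 2) x y (G x y - G' x y) w := rfl
  rw [h5, h3]
  simp

/-- The Jacobi endomorphism of `S₀ - 2 P 𝒞` vanishes when `d_{h₀} P = P d_J P`. -/
theorem jacobiEndomorphism_projSpray_eq_zero (hU : IsOpen U) {P : E → E → ℝ}
    (hP : ContDiffOn ℝ ∞ (fun p : E × E => P p.1 p.2) (slit U))
    (hom : ∀ x ∈ U, ∀ y : E, y ≠ 0 → ∀ r : ℝ, 0 < r → P x (r • y) = r * P x y)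
    (hfunk : ∀ x ∈ U, ∀ y : E, y ≠ 0 → dX P x y = P x y • dJ P x y)
    (hamel : ∀ x ∈ U, ∀ y : E, y ≠ 0 → eulerLagrange flatSpray P x y = 0)
    (hx : x ∈ U) (hy : y ≠ 0) : jacobiEndomorphism (projSpray P) x y = 0 := by
  have hO := isOpen_slit hU
  have h : (x, y) ∈ slit U := ⟨hx, hy⟩
  have dP := differentiableAt_of_smoothOn hO hP h
  have dA := differentiableAt_of_smoothOn hO (smoothOn_dJ hO hP) h
  have hPy : dJ P x y y = P x y := by
    simpa using dJ_self_of_homogeneous 1 dP fun r hr => by simpa using hom x hx y hy r hr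
  have hAy : dJ (dJ P) x y y = 0 := by
    have := fderiv_self_of_homogeneous (L := dJ P x) (y := y) 0 (differentiableAt_snd_slice dA)
      fun r hr => fderiv_smul_of_homogeneous 0 hy
        (fun z hz r hr => by simpa using hom x hx z hz r hr) hr
    rwa [Nat.cast_zero, zero_smul] at this
  have hXG : ∀ w, dX (projSpray P) x y w = (P x y * dJ P x y w) • y := by
    intro w
    have : HasFDerivAt (fun z => P z y • y) _ x :=
      ((dP.comp (f := fun z => (z, y)) x (by fun_prop)).hasFDerivAt).smul_const y
    change fderiv ℝ (fun z => P z y • y) x w = _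
    rw [this.fderiv]
    change (dX P x y w) • y = _
    rw [hfunk x hx y hy]
    rfl
  have hJG : ∀ p ∈ slit U, dJ (projSpray P) p.1 p.2 =
      P p.1 p.2 • ContinuousLinearMap.id ℝ E + (dJ P p.1 p.2).smulRight p.2 := fun p hp =>
    ((differentiableAt_snd_slice (differentiableAt_of_smoothOn hO hP hp)).hasFDerivAt.smul
      (hasFDerivAt_id p.2)).fderiv
  have hS : ∀ w, sprayDeriv (projSpray P) (dJ (projSpray P)) x y w =
      -(P x y ^ 2) • w - (P x y * dJ P x y w) • y := by
    intro w
    -- `S₀P = d_{h₀}P(y) = P²`, and the vertical part contributes `-2P d_JP(y) = -2P²`.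
    have hSP : sprayDeriv (projSpray P) P x y = -(P x y ^ 2) := by
      rw [sprayDeriv_eq _ dP, sprayDeriv_flat_eq_dX dP, hfunk x hx y hy, projSpray, map_smul, hPy]
      simp only [smul_apply, hPy, smul_eq_mul]
      ring
    -- `d_JP` is 0-homogeneous, so the vertical part contributes nothing; Hamel's equation turns
    -- `S₀(d_JP)` into `d_{h₀}P`.
    have hSA : sprayDeriv (projSpray P) (dJ P) x y = P x y • dJ P x y := by
      rw [sprayDeriv_eq _ dA, projSpray, map_smul, hAy, smul_zero, smul_zero, sub_zero,
        ← hfunk x hx y hy]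
      exact sub_eq_zero.1 (hamel x hx y hy)
    rw [sprayDeriv, fderiv_congr_on hO h (M := fun x y => P x y • ContinuousLinearMap.id ℝ E +
      (dJ P x y).smulRight y) hJG]
    have hd : HasFDerivAt (fun p : E × E => (P p.1 p.2 • ContinuousLinearMap.id ℝ E +
        (dJ P p.1 p.2).smulRight p.2) w)
        (((fderiv ℝ (fun p : E × E => P p.1 p.2) (x, y)).smulRight w) +
          (dJ P x y w • ContinuousLinearMap.snd ℝ E E +
          (((ContinuousLinearMap.apply ℝ ℝ w).comp
            (fderiv ℝ (fun p : E × E => dJ P p.1 p.2) (x, y))).smulRight y))) (x, y) :=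
      (dP.hasFDerivAt.smul_const w).add
        ((((ContinuousLinearMap.apply ℝ ℝ w).hasFDerivAt.comp (x, y) dA.hasFDerivAt)).smul
          hasFDerivAt_snd)
    -- Differentiability of the operator-valued map allows evaluation at `w` to be exchanged with
    -- the derivative, reducing the computation to `hd`.
    have hdiff : DifferentiableAt ℝ (fun p : E × E => P p.1 p.2 • ContinuousLinearMap.id ℝ E +
        (dJ P p.1 p.2).smulRight p.2) (x, y) := by
      have hsr : DifferentiableAt ℝ (fun p : E × E =>
          ContinuousLinearMap.smulRightL ℝ E E (dJ P p.1 p.2) p.2) (x, y) :=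
        ((ContinuousLinearMap.smulRightL ℝ E E).differentiableAt.comp (x, y) dA).clm_apply
          differentiableAt_snd
      exact (dP.smul_const _).add hsr
    have happ := ((ContinuousLinearMap.apply ℝ E w).hasFDerivAt.comp (x, y)
      hdiff.hasFDerivAt).unique hd
    have := congrArg (fun T => T (sprayField (projSpray P) x y)) happ
    simp only [ContinuousLinearMap.comp_apply, ContinuousLinearMap.apply_apply] at this
    rw [this]
    have e1 : fderiv ℝ (fun p : E × E => P p.1 p.2) (x, y) (sprayField (projSpray P) x y) =
      -(P x y ^ 2) := hSP
    have e2 : fderiv ℝ (fun p : E × E => dJ P p.1 p.2) (x, y) (sprayField (projSpray P) x y) =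
      P x y • dJ P x y := hSA
    simp only [add_apply, ContinuousLinearMap.smulRight_apply, e1, smul_apply,
      ContinuousLinearMap.comp_apply, e2, ContinuousLinearMap.apply_apply,
      ContinuousLinearMap.coe_snd', smul_eq_mul]
    simp only [sprayField, projSpray]
    module
  ext w
  simp only [jacobiEndomorphism, add_apply, sub_apply, smul_apply, ContinuousLinearMap.comp_apply,
    hXG, hS, hJG (x, y) h, ContinuousLinearMap.smulRight_apply, ContinuousLinearMap.id_apply,
    map_add, map_smul, hPy, zero_apply]
  module

end Geodesic

/-! ### Deformations `gF̄ + (f/F)F̄` and their flatness criterion. -/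

section Deformation

variable {E : Type*} [NormedAddCommGroup E] [NormedSpace ℝ E]
variable {U : Set E} {F Fbar : E → E → ℝ} {g : E → ℝ} {f : E → E →L[ℝ] ℝ} {x y : E}

theorem dJ_oneForm (f : E → E →L[ℝ] ℝ) (x y : E) : dJ (fun x y => f x y) x y = f x :=
  (f x).fderiv

theorem smoothOn_oneForm (hf : ContDiffOn ℝ ∞ f U) :
    ContDiffOn ℝ ∞ (fun p : E × E => f p.1 p.2) (slit U) :=
  (hf.comp contDiffOn_fst fun _ hp => hp.1).clm_apply contDiffOn_snd

theorem smoothOn_base (hg : ContDiffOn ℝ ∞ g U) :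
    ContDiffOn ℝ ∞ (fun p : E × E => g p.1) (slit U) :=
  hg.comp contDiffOn_fst fun _ hp => hp.1

theorem eulerLagrange_flat_base (g : E → ℝ) (x y : E) :
    eulerLagrange flatSpray (fun x _ => g x) x y = -dX (fun x (_ : E) => g x) x y := by
  have h : dJ (fun x (_ : E) => g x) = fun _ _ => 0 := by
    funext x y
    exact fderiv_const_apply _
  rw [eulerLagrange, h, sprayDeriv]
  simp

/-- For `f` linear in `y`, `δ_{S₀} f` at `w` is `(D_y f)(w) - (D_w f)(y) = df(y, w)`. -/
theorem eulerLagrange_flat_oneForm_of_closed (hU : IsOpen U) (hf : ContDiffOn ℝ ∞ f U)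
    (hx : x ∈ U) (hclosed : ∀ u w, dOneForm f x u w = 0) :
    eulerLagrange flatSpray (fun x y => f x y) x y = 0 := by
  have df : HasFDerivAt f (fderiv ℝ f x) x :=
    ((hf.contDiffAt (hU.mem_nhds hx)).differentiableAt (by simp)).hasFDerivAt
  have h1 : fderiv ℝ (fun p : E × E => dJ (fun x y => f x y) p.1 p.2) (x, y) =
      (fderiv ℝ f x).comp (ContinuousLinearMap.fst ℝ E E) := by
    simp only [dJ_oneForm]
    exact (df.comp (x, y) hasFDerivAt_fst).fderiv
  have h2 : ∀ w, dX (fun x y => f x y) x y w = fderiv ℝ f x w y := by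
    intro w
    have := (df.clm_apply (hasFDerivAt_const y x)).fderiv
    rw [dX, this]
    simp
  ext w
  rw [eulerLagrange, sub_apply, sprayDeriv_flat, h1, h2]
  exact hclosed y w

/-- Writing `f = qF` puts both sides in terms of `q`, `F`, `F̄`, `g` and their first derivatives,
apart from `δ_{S₀} q`, which closedness of `f` eliminates. -/
theorem flatnessForm_eq_neg_eulerLagrange (hU : IsOpen U)
    (hF : IsPreFinslerOn U F) (hFbar : IsPreFinslerOn U Fbar)
    (hδF : eulerLagrange flatSpray F x y = 0) (hδFbar : eulerLagrange flatSpray Fbar x y = 0)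
    (hg : ContDiffOn ℝ ∞ g U) (hf : ContDiffOn ℝ ∞ f U)
    (hclosed : ∀ u w, dOneForm f x u w = 0) (hx : x ∈ U) (hy : y ≠ 0) (w : E) :
    flatnessForm F Fbar g f x y w =
      -eulerLagrange flatSpray (deformation F Fbar g f) x y w := by
  have hO := isOpen_slit hU
  have h : (x, y) ∈ slit U := ⟨hx, hy⟩
  have hpos := hF.pos x hx y hy
  have hg' := smoothOn_base (E := E) hg
  have hf' := smoothOn_oneForm hf
  set q : E → E → ℝ := fun x y => f x y / F x y with hqdef
  have hq : ContDiffOn ℝ ∞ (fun p : E × E => q p.1 p.2) (slit U) :=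
    hf'.div hF.smooth fun p hp => (hF.pos p.1 hp.1 p.2 hp.2).ne'
  have hqF : ∀ p ∈ slit U, f p.1 p.2 = q p.1 p.2 * F p.1 p.2 := fun p hp =>
    (div_mul_cancel₀ _ (hF.pos p.1 hp.1 p.2 hp.2).ne').symm
  have dF := differentiableAt_of_smoothOn hO hF.smooth h
  have dq := differentiableAt_of_smoothOn hO hq h
  have e0 := hqF (x, y) h
  have e1 : dJ (fun x y => f x y) x y w = q x y * dJ F x y w + F x y * dJ q x y w := by
    rw [dJ_congr_on (L := fun x y => f x y) (M := fun x y => q x y * F x y) hO h hqF, dJ_mul dq dF]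
    simp
  have e2 : sprayDeriv flatSpray (fun x y => f x y) x y =
      q x y * sprayDeriv flatSpray F x y + F x y * sprayDeriv flatSpray q x y := by
    rw [sprayDeriv_congr_on (L := fun x y => f x y) (M := fun x y => q x y * F x y) _ hO h hqF,
      sprayDeriv_mul _ dq dF]
  -- The relation `0 = δ_{S₀} f = δ_{S₀}(qF)`, with `δ_{S₀}F = 0`; `e5` solves it for `δ_{S₀} q`.
  have e3 : 0 = F x y * eulerLagrange flatSpray q x y w +
      sprayDeriv flatSpray q x y * dJ F x y w + sprayDeriv flatSpray F x y * dJ q x y w := by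
    have := eulerLagrange_flat_oneForm_of_closed (y := y) hU hf hx hclosed
    rw [eulerLagrange_congr_on (L := fun x y => f x y) (M := fun x y => q x y * F x y) _ hO h hqF,
      eulerLagrange_mul _ hO hq hF.smooth h, hδF] at this
    simpa using (congrArg (fun T => T w) this).symm
  have e4 : eulerLagrange flatSpray (deformation F Fbar g f) x y w =
      -(Fbar x y * dX (fun x (_ : E) => g x) x y w) +
      sprayDeriv flatSpray (fun x (_ : E) => g x) x y * dJ Fbar x y w +
      (Fbar x y * eulerLagrange flatSpray q x y w + sprayDeriv flatSpray q x y * dJ Fbar x y w +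
        sprayDeriv flatSpray Fbar x y * dJ q x y w) := by
    have hJg : dJ (fun x (_ : E) => g x) x y = 0 := fderiv_const_apply _
    change eulerLagrange flatSpray (fun x y => g x * Fbar x y + q x y * Fbar x y) x y w = _
    rw [eulerLagrange_add (A := fun x y => g x * Fbar x y) (B := fun x y => q x y * Fbar x y)
      _ hO (hg'.mul hFbar.smooth) (hq.mul hFbar.smooth) h,
      eulerLagrange_mul (A := fun x _ => g x) _ hO hg' hFbar.smooth h,
      eulerLagrange_mul _ hO hq hFbar.smooth h, hδFbar, hJg, eulerLagrange_flat_base]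
    simp
  rw [e4]
  simp only [flatnessForm, e1, e2]
  simp only [] at e0
  rw [e0]
  have e5 : eulerLagrange flatSpray q x y w = -(sprayDeriv flatSpray q x y * dJ F x y w +
      sprayDeriv flatSpray F x y * dJ q x y w) / F x y := by
    field_simp
    linarith
  rw [e5]
  field_simp
  ring

/-- The criterion for a deformation of projectively flat metrics to be projectively flat. -/
theorem isProjectivelyFlatOn_deformation_iff (hU : IsOpen U)
    (hF : IsPreFinslerOn U F) (hFflat : IsProjectivelyFlatOn U F)
    (hFbar : IsPreFinslerOn U Fbar) (hFbarflat : IsProjectivelyFlatOn U Fbar)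
    (hg : ContDiffOn ℝ ∞ g U) (hf : ContDiffOn ℝ ∞ f U)
    (hclosed : ∀ x ∈ U, ∀ u w, dOneForm f x u w = 0)
    (hdef : IsPreFinslerOn U (deformation F Fbar g f)) :
    IsProjectivelyFlatOn U (deformation F Fbar g f) ↔
      ∀ x ∈ U, ∀ y, y ≠ 0 → ∀ w, flatnessForm F Fbar g f x y w = 0 := by
  rw [hF.isProjectivelyFlatOn_iff hU] at hFflat
  rw [hFbar.isProjectivelyFlatOn_iff hU] at hFbarflat
  rw [hdef.isProjectivelyFlatOn_iff hU]
  refine forall₄_congr fun x hx y hy => ?_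
  rw [ContinuousLinearMap.ext_iff]
  refine forall_congr' fun w => ?_
  rw [flatnessForm_eq_neg_eulerLagrange hU hF hFbar (hFflat x hx y hy) (hFbarflat x hx y hy) hg hf
    (hclosed x hx) hx hy w, neg_eq_zero, zero_apply]

end Deformation

/-! ### The explicit family: algebra of `r`, `F` and `ξ = y + 2cFx`. -/

section Families

variable {E : Type*} [NormedAddCommGroup E] [InnerProductSpace ℝ E]
variable {U : Set E} {c η e : ℝ} {v x y : E}

theorem root_radicand_pos (hx : 4 * c ^ 2 * ‖x‖ ^ 2 < 1) (hy : y ≠ 0) :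
    0 < ‖y‖ ^ 2 - 4 * c ^ 2 * (‖x‖ ^ 2 * ‖y‖ ^ 2 - inner ℝ x y ^ 2) := by
  have h1 : 0 < (1 - 4 * c ^ 2 * ‖x‖ ^ 2) * ‖y‖ ^ 2 :=
    mul_pos (by linarith) (pow_pos (norm_pos_iff.2 hy) 2)
  nlinarith [sq_nonneg (c * inner ℝ x y)]

theorem root_pos (hx : 4 * c ^ 2 * ‖x‖ ^ 2 < 1) (hy : y ≠ 0) : 0 < root c x y :=
  Real.sqrt_pos.2 (root_radicand_pos hx hy)

theorem root_sq (hx : 4 * c ^ 2 * ‖x‖ ^ 2 < 1) (hy : y ≠ 0) :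
    root c x y ^ 2 = ‖y‖ ^ 2 - 4 * c ^ 2 * (‖x‖ ^ 2 * ‖y‖ ^ 2 - inner ℝ x y ^ 2) :=
  Real.sq_sqrt (root_radicand_pos hx hy).le

/-- `r² - (2c⟨x,y⟩)² = (1 - 4c²|x|²)|y|² > 0`. This yields both the positivity of `F` and the bound
`F ≤ 2r/(1 - 4c²|x|²)`. -/
theorem abs_inner_lt_root (hx : 4 * c ^ 2 * ‖x‖ ^ 2 < 1) (hy : y ≠ 0) :
    |2 * c * inner ℝ x y| < root c x y := by
  refine abs_lt_of_sq_lt_sq ?_ (root_pos hx hy).le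
  have h1 : 0 < (1 - 4 * c ^ 2 * ‖x‖ ^ 2) * ‖y‖ ^ 2 :=
    mul_pos (by linarith) (pow_pos (norm_pos_iff.2 hy) 2)
  rw [root_sq hx hy]
  linarith

theorem randers_eq_div (c : ℝ) (x y : E) :
    randers c x y = (root c x y + 2 * c * inner ℝ x y) / (1 - 4 * c ^ 2 * ‖x‖ ^ 2) :=
  (add_div _ _ _).symm

theorem randers_pos (hx : 4 * c ^ 2 * ‖x‖ ^ 2 < 1) (hy : y ≠ 0) : 0 < randers c x y := by
  rw [randers_eq_div]
  have := neg_lt_of_abs_lt (abs_inner_lt_root hx hy)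
  exact div_pos (by linarith) (by linarith)

theorem root_add_eq (hx : 4 * c ^ 2 * ‖x‖ ^ 2 < 1) (y : E) :
    root c x y + 2 * c * inner ℝ x y = (1 - 4 * c ^ 2 * ‖x‖ ^ 2) * randers c x y := by
  rw [randers_eq_div, mul_div_cancel₀]
  linarith

/-- The implicit equation of a Funk-type metric: `y/F + 2cx` is a unit vector. It follows by
squaring `r = (1 - 4c²|x|²)F - 2c⟨x,y⟩` and cancelling `1 - 4c²|x|²`. -/
theorem norm_sq_add_randers_smul (hx : 4 * c ^ 2 * ‖x‖ ^ 2 < 1) (hy : y ≠ 0) :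
    ‖y + (2 * c * randers c x y) • x‖ ^ 2 = randers c x y ^ 2 := by
  have h1 := root_sq hx hy
  have h2 := root_add_eq hx y
  have hA : 1 - 4 * c ^ 2 * ‖x‖ ^ 2 ≠ 0 := by linarith
  rw [norm_add_sq_real, inner_smul_right, norm_smul, mul_pow, Real.norm_eq_abs, sq_abs,
    real_inner_comm]
  rw [show root c x y = (1 - 4 * c ^ 2 * ‖x‖ ^ 2) * randers c x y - 2 * c * inner ℝ x y by
    linarith] at h1
  refine mul_left_cancel₀ hA ?_
  linear_combination -h1

/-- This form of `r` is the coefficient of `dF` when `|ξ|² = F²` is differentiated, and it involves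
no square root of its own to differentiate. -/
theorem root_eq_sub (hx : 4 * c ^ 2 * ‖x‖ ^ 2 < 1) (y : E) :
    root c x y = randers c x y - 2 * c * inner ℝ (y + (2 * c * randers c x y) • x) x := by
  have h2 := root_add_eq hx y
  rw [inner_add_left, real_inner_smul_left, real_inner_self_eq_norm_sq, real_inner_comm]
  linear_combination h2

theorem berwald_eq (hx : 4 * c ^ 2 * ‖x‖ ^ 2 < 1) (η : ℝ) (y : E) :
    berwald c η x y = η * randers c x y ^ 2 / root c x y := by
  have hA : 1 - 4 * c ^ 2 * ‖x‖ ^ 2 ≠ 0 := by linarith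
  rw [berwald, root_add_eq hx, mul_pow, mul_left_comm, mul_div_mul_left _ _ (pow_ne_zero 2 hA)]

/-- The choice of `g` and `f` is made so that `gF + f = ⟨v,ξ⟩ + eF`. -/
theorem conformalFamily_eq (hx : 4 * c ^ 2 * ‖x‖ ^ 2 < 1) (η e : ℝ) (v : E) (hy : y ≠ 0) :
    conformalFamily c η e v x y = η * randers c x y *
      (inner ℝ v (y + (2 * c * randers c x y) • x) + e * randers c x y) / root c x y := by
  have hF := (randers_pos hx hy).ne'
  have hr := (root_pos hx hy).ne'
  rw [conformalFamily, deformation, berwald_eq hx, inner_add_right, real_inner_smul_right,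
    innerSL_apply_apply]
  field_simp
  ring

/-! ### Homogeneity, smoothness and continuity of the family. -/

theorem root_smul (c : ℝ) (x y : E) {r : ℝ} (hr : 0 < r) :
    root c x (r • y) = r * root c x y := by
  rw [root, root, norm_smul, real_inner_smul_right, Real.norm_of_nonneg hr.le,
    ← Real.sqrt_sq hr.le, ← Real.sqrt_mul (sq_nonneg r), Real.sqrt_sq hr.le]
  congr 1
  ring

theorem randers_smul (c : ℝ) (x y : E) {r : ℝ} (hr : 0 < r) :
    randers c x (r • y) = r * randers c x y := by
  rw [randers, randers, root_smul c x y hr, real_inner_smul_right]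
  ring

theorem berwald_smul (c η : ℝ) (x y : E) {r : ℝ} (hr : 0 < r) :
    berwald c η x (r • y) = r * berwald c η x y := by
  rw [berwald, berwald, root_smul c x y hr, real_inner_smul_right, ← mul_div_assoc,
    ← mul_div_mul_left (r * _) _ hr.ne']
  congr 1 <;> ring

theorem conformalFamily_smul (c η e : ℝ) (v x y : E) {r : ℝ} (hr : 0 < r) :
    conformalFamily c η e v x (r • y) = r * conformalFamily c η e v x y := by
  rw [conformalFamily, deformation, deformation, berwald_smul c η x y hr, randers_smul c x y hr,
    map_smul, smul_eq_mul, mul_div_mul_left _ _ hr.ne']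
  ring

theorem contDiff_root_radicand (c : ℝ) : ContDiff ℝ ∞ fun p : E × E =>
    ‖p.2‖ ^ 2 - 4 * c ^ 2 * (‖p.1‖ ^ 2 * ‖p.2‖ ^ 2 - inner ℝ p.1 p.2 ^ 2) := by
  have h1 : ContDiff ℝ ∞ fun p : E × E => ‖p.1‖ ^ 2 := contDiff_fst.norm_sq ℝ
  have h2 : ContDiff ℝ ∞ fun p : E × E => ‖p.2‖ ^ 2 := contDiff_snd.norm_sq ℝ
  have h3 : ContDiff ℝ ∞ fun p : E × E => (inner ℝ p.1 p.2 : ℝ) := contDiff_fst.inner ℝ contDiff_snd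
  exact h2.sub (contDiff_const.mul ((h1.mul h2).sub (h3.pow 2)))

theorem smoothOn_root (hU : ∀ x ∈ U, 4 * c ^ 2 * ‖x‖ ^ 2 < 1) :
    ContDiffOn ℝ ∞ (fun p : E × E => root c p.1 p.2) (slit U) :=
  (contDiff_root_radicand c).contDiffOn.sqrt fun p hp =>
    (root_radicand_pos (hU p.1 hp.1) hp.2).ne'

theorem smoothOn_randers (hU : ∀ x ∈ U, 4 * c ^ 2 * ‖x‖ ^ 2 < 1) :
    ContDiffOn ℝ ∞ (fun p : E × E => randers c p.1 p.2) (slit U) := by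
  have h1 : ContDiff ℝ ∞ fun p : E × E => ‖p.1‖ ^ 2 := contDiff_fst.norm_sq ℝ
  have h3 : ContDiff ℝ ∞ fun p : E × E => (inner ℝ p.1 p.2 : ℝ) := contDiff_fst.inner ℝ contDiff_snd
  simp only [randers_eq_div]
  exact ((smoothOn_root hU).add (contDiff_const.mul h3).contDiffOn).div
    (contDiff_const.sub (contDiff_const.mul h1)).contDiffOn fun p hp => by
      have := hU p.1 hp.1
      linarith

theorem smoothOn_conformalFamily (hU : ∀ x ∈ U, 4 * c ^ 2 * ‖x‖ ^ 2 < 1) (η e : ℝ) (v : E) :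
    ContDiffOn ℝ ∞ (fun p : E × E => conformalFamily c η e v p.1 p.2) (slit U) := by
  have hF := smoothOn_randers hU
  have h1 : ContDiffOn ℝ ∞ (fun p : E × E =>
      (inner ℝ v (p.2 + (2 * c * randers c p.1 p.2) • p.1) : ℝ)) (slit U) :=
    contDiffOn_const.inner ℝ (contDiffOn_snd.add ((contDiffOn_const.mul hF).smul contDiffOn_fst))
  exact (((contDiffOn_const.mul hF).mul (h1.add (contDiffOn_const.mul hF))).div (smoothOn_root hU)
    fun p hp => (root_pos (hU p.1 hp.1) hp.2).ne').congr fun p hp =>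
      conformalFamily_eq (hU p.1 hp.1) η e v hp.2

/-- For `y ≠ 0`, `|ξ| = F` and Cauchy-Schwarz bound the numerator by a multiple of `F²`, and `F` is
at most a multiple of `r`. The bound tends to zero at the zero section, where smoothness is not
available. -/
theorem abs_conformalFamily_le (hx : 4 * c ^ 2 * ‖x‖ ^ 2 < 1) (hη : 0 < η) (e : ℝ) (v y : E) :
    |conformalFamily c η e v x y| ≤
      4 * η * (‖v‖ + |e|) * root c x y / (1 - 4 * c ^ 2 * ‖x‖ ^ 2) ^ 2 := by
  have hA : 0 < 1 - 4 * c ^ 2 * ‖x‖ ^ 2 := by linarith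
  rcases eq_or_ne y 0 with rfl | hy
  · simp [conformalFamily, deformation, berwald, root]
  have hr := root_pos hx hy
  have hF := randers_pos hx hy
  have hFr : randers c x y ≤ 2 * root c x y / (1 - 4 * c ^ 2 * ‖x‖ ^ 2) := by
    rw [randers_eq_div]
    have := (abs_lt.1 (abs_inner_lt_root hx hy)).2
    gcongr
    linarith
  have hξ : ‖y + (2 * c * randers c x y) • x‖ = randers c x y :=
    (sq_eq_sq₀ (norm_nonneg _) hF.le).1 (norm_sq_add_randers_smul hx hy)
  have hψ : |inner ℝ v (y + (2 * c * randers c x y) • x) + e * randers c x y| ≤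
      (‖v‖ + |e|) * randers c x y := by
    refine (abs_add_le _ _).trans ?_
    rw [add_mul, abs_mul e, abs_of_pos hF]
    gcongr
    simpa [hξ] using abs_real_inner_le_norm v (y + (2 * c * randers c x y) • x)
  rw [conformalFamily_eq hx η e v hy, abs_div, abs_mul, abs_mul, abs_of_pos hη, abs_of_pos hF,
    abs_of_pos hr, div_le_iff₀ hr]
  calc η * randers c x y * |inner ℝ v (y + (2 * c * randers c x y) • x) + e * randers c x y|
      ≤ η * randers c x y * ((‖v‖ + |e|) * randers c x y) := by gcongr
    _ = η * (‖v‖ + |e|) * randers c x y ^ 2 := by ring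
    _ ≤ η * (‖v‖ + |e|) * (2 * root c x y / (1 - 4 * c ^ 2 * ‖x‖ ^ 2)) ^ 2 := by gcongr
    _ = _ := by
      field_simp
      ring

theorem continuousOn_conformalFamily (hUo : IsOpen U) (hU : ∀ x ∈ U, 4 * c ^ 2 * ‖x‖ ^ 2 < 1)
    (hη : 0 < η) (e : ℝ) (v : E) :
    ContinuousOn (fun p : E × E => conformalFamily c η e v p.1 p.2) (U ×ˢ Set.univ) := by
  rintro ⟨x, y⟩ ⟨hx, -⟩
  rcases eq_or_ne y 0 with rfl | hy
  · have h0 : conformalFamily c η e v x 0 = 0 := by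
      simp [conformalFamily, deformation, berwald, root]
    have hA : (1 - 4 * c ^ 2 * ‖x‖ ^ 2) ^ 2 ≠ 0 := pow_ne_zero 2 (by linarith [hU x hx])
    have hcont : ContinuousAt (fun p : E × E =>
        4 * η * (‖v‖ + |e|) * root c p.1 p.2 / (1 - 4 * c ^ 2 * ‖p.1‖ ^ 2) ^ 2) (x, 0) := by
      have hr : Continuous fun p : E × E => root c p.1 p.2 :=
        (contDiff_root_radicand c).continuous.sqrt
      exact (continuous_const.mul hr).continuousAt.div (by fun_prop) hA
    have hlim := hcont.tendsto
    rw [show root c x 0 = 0 by simp [root], mul_zero, zero_div] at hlim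
    rw [ContinuousWithinAt, h0]
    refine squeeze_zero_norm' ?_ (hlim.mono_left nhdsWithin_le_nhds)
    filter_upwards [self_mem_nhdsWithin] with p hp
    exact abs_conformalFamily_le (hU p.1 hp.1) hη e v p.2
  · exact ((smoothOn_conformalFamily hU η e v).contDiffAt
      ((isOpen_slit hUo).mem_nhds ⟨hx, hy⟩)).continuousAt.continuousWithinAt

theorem isPreFinslerOn_conformalFamily (hUo : IsOpen U) (hU : ∀ x ∈ U, 4 * c ^ 2 * ‖x‖ ^ 2 < 1)
    (hη : 0 < η) (hpos : ∀ x ∈ U, ∀ y, y ≠ 0 → 0 < conformalFamily c η e v x y) :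
    IsPreFinslerOn U (conformalFamily c η e v) where
  continuousOn := continuousOn_conformalFamily hUo hU hη e v
  smooth := smoothOn_conformalFamily hU η e v
  pos := hpos
  homogeneous x _ y _ hr := conformalFamily_smul c η e v x y hr

/-! ### First-order equations for `F` and `F̃`, and flatness. -/

theorem root_mul_fderiv_randers (hUo : IsOpen U) (hU : ∀ x ∈ U, 4 * c ^ 2 * ‖x‖ ^ 2 < 1)
    (hx : x ∈ U) (hy : y ≠ 0) (w : E × E) :
    root c x y * fderiv ℝ (fun p : E × E => randers c p.1 p.2) (x, y) w =
      inner ℝ (y + (2 * c * randers c x y) • x) (w.2 + (2 * c * randers c x y) • w.1) := by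
  have hO := isOpen_slit hUo
  have h : (x, y) ∈ slit U := ⟨hx, hy⟩
  have dF := (differentiableAt_of_smoothOn hO (smoothOn_randers hU) h).hasFDerivAt
  have hξ : HasFDerivAt (fun p : E × E => p.2 + (2 * c * randers c p.1 p.2) • p.1) _ (x, y) :=
    hasFDerivAt_snd.add ((dF.const_mul (2 * c)).smul hasFDerivAt_fst)
  -- Differentiate `|ξ|² = F²`. The terms in `dF` collect with coefficient `F - 2c⟨ξ,x⟩ = r`.
  have h1 := hξ.norm_sq.fderiv
  rw [fderiv_congr_on (L := fun x y => ‖y + (2 * c * randers c x y) • x‖ ^ 2)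
    (M := fun x y => randers c x y ^ 2) hO h fun p hp =>
      norm_sq_add_randers_smul (hU p.1 hp.1) hp.2, (dF.pow 2).fderiv] at h1
  have h2 := congrArg (fun T => T w) h1
  rw [root_eq_sub (hU x hx)]
  set D := fderiv ℝ (fun p : E × E => randers c p.1 p.2) (x, y) w
  simp only [add_apply, smul_apply, ContinuousLinearMap.comp_apply, innerSL_apply_apply,
    ContinuousLinearMap.smulRight_apply, ContinuousLinearMap.coe_snd', ContinuousLinearMap.coe_fst',
    smul_eq_mul, nsmul_eq_mul, inner_add_right, real_inner_smul_right] at h2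
  simp only [inner_add_right, real_inner_smul_right]
  push_cast at h2
  linear_combination h2 / 2

/-- By `root_mul_fderiv_randers`, `r dF` takes the value `2cF⟨ξ,w⟩` on `(w, 0)` and `⟨ξ,w⟩` on `(0,
w)`. -/
theorem dX_randers (hUo : IsOpen U) (hU : ∀ x ∈ U, 4 * c ^ 2 * ‖x‖ ^ 2 < 1) (hx : x ∈ U)
    (hy : y ≠ 0) : dX (randers c) x y = (2 * c * randers c x y) • dJ (randers c) x y := by
  have dF := differentiableAt_of_smoothOn (isOpen_slit hUo) (smoothOn_randers hU)
    (show (x, y) ∈ slit U from ⟨hx, hy⟩)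
  ext w
  refine mul_left_cancel₀ (root_pos (hU x hx) hy).ne' ?_
  have h1 := root_mul_fderiv_randers hUo hU hx hy (w, 0)
  have h2 := root_mul_fderiv_randers hUo hU hx hy (0, w)
  rw [smul_apply, dX_apply dF, dJ_apply dF, smul_eq_mul, mul_left_comm, h1, h2]
  simp [real_inner_smul_right]

/-- `d_{h₀} F̃ = 2 c d_J (F F̃)`. -/
theorem dX_conformalFamily (hUo : IsOpen U) (hU : ∀ x ∈ U, 4 * c ^ 2 * ‖x‖ ^ 2 < 1) (hx : x ∈ U)
    (hy : y ≠ 0) : dX (conformalFamily c η e v) x y =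
      (2 * c) • (randers c x y • dJ (conformalFamily c η e v) x y +
        conformalFamily c η e v x y • dJ (randers c) x y) := by
  have hO := isOpen_slit hUo
  have h : (x, y) ∈ slit U := ⟨hx, hy⟩
  have dF := differentiableAt_of_smoothOn hO (smoothOn_randers hU) h
  have dL := differentiableAt_of_smoothOn hO (smoothOn_conformalFamily hU η e v) h
  have hFD := dF.hasFDerivAt
  have hr := (root_pos (hU x hx) hy).ne'
  have hξ : HasFDerivAt (fun p : E × E => p.2 + (2 * c * randers c p.1 p.2) • p.1) _ (x, y) :=
    hasFDerivAt_snd.add ((hFD.const_mul (2 * c)).smul hasFDerivAt_fst)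
  have hroot : HasFDerivAt (fun p : E × E => randers c p.1 p.2 -
      2 * c * inner ℝ (p.2 + (2 * c * randers c p.1 p.2) • p.1) p.1) _ (x, y) :=
    hFD.sub ((hξ.inner ℝ hasFDerivAt_fst).const_mul (2 * c))
  have hrhs : HasFDerivAt (fun p : E × E => η * randers c p.1 p.2 *
      (inner ℝ v (p.2 + (2 * c * randers c p.1 p.2) • p.1) + e * randers c p.1 p.2)) _ (x, y) :=
    (hFD.const_mul η).mul
      (((hasFDerivAt_const v (x, y)).inner ℝ hξ).add (hFD.const_mul e))
  -- The identity to differentiate is `F̃ r = ηF(⟨v,ξ⟩ + eF)`, with `r` written as `F - 2c⟨ξ,x⟩`.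
  have h1 := (dL.hasFDerivAt.fun_mul hroot).fderiv
  rw [fderiv_congr_on (L := fun x y => conformalFamily c η e v x y * (randers c x y -
      2 * c * inner ℝ (y + (2 * c * randers c x y) • x) x))
    (M := fun x y => η * randers c x y *
      (inner ℝ v (y + (2 * c * randers c x y) • x) + e * randers c x y)) hO h
      (fun p hp => by
        rw [← root_eq_sub (hU p.1 hp.1), conformalFamily_eq (hU p.1 hp.1) η e v hp.2,
          div_mul_cancel₀ _ (root_pos (hU p.1 hp.1) hp.2).ne']), hrhs.fderiv] at h1
  ext w
  have hX := congrArg (fun T => T (w, 0)) h1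
  have hJ := congrArg (fun T => T (0, w)) h1
  have hFX := congrArg (fun T => T w) (dX_randers hUo hU hx hy)
  have hrF := root_mul_fderiv_randers hUo hU hx hy (0, w)
  rw [← dJ_apply dF] at hrF
  simp only [smul_apply, smul_eq_mul] at hFX
  simp only [add_apply, sub_apply, smul_apply, ContinuousLinearMap.comp_apply,
    ContinuousLinearMap.smulRight_apply, ContinuousLinearMap.coe_snd', ContinuousLinearMap.coe_fst',
    ContinuousLinearMap.prod_apply, fderivInnerCLM_apply, zero_apply,
    ← dX_apply dF, ← dJ_apply dF, ← dX_apply dL, ← dJ_apply dL, hFX,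
    smul_eq_mul, inner_add_right, inner_add_left, real_inner_smul_right, real_inner_smul_left,
    inner_zero_left, inner_zero_right, smul_zero, add_zero, zero_add] at hX hJ hrF
  have hroot' := root_eq_sub (hU x hx) y
  simp only [inner_add_left, real_inner_smul_left] at hroot'
  simp only [add_apply, smul_apply, smul_eq_mul]
  refine mul_left_cancel₀ hr ?_
  rw [hroot'] at hrF ⊢
  rw [real_inner_comm x w] at *
  -- The horizontal derivatives of `F` and `ξ` are `2cF` times the vertical ones. Only the explicit
  -- `x` in `⟨ξ,x⟩` breaks this pattern; it leaves `2cF̃⟨ξ,w⟩ = 2cF̃ r d_JF(w)`.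
  linear_combination -hX + 2 * c * randers c x y * hJ - 2 * c * conformalFamily c η e v x y * hrF

/-- If `M = S₀ L` satisfies `d_J M = 2 d_{h₀} L`, then `δ_{S₀} L = 0`. -/
theorem eulerLagrange_flat_eq_zero_of_dJ_eq (hUo : IsOpen U) {L M : E → E → ℝ}
    (hL : ContDiffOn ℝ ∞ (fun p : E × E => L p.1 p.2) (slit U)) (hx : x ∈ U) (hy : y ≠ 0)
    (hS : ∀ p ∈ slit U, sprayDeriv flatSpray L p.1 p.2 = M p.1 p.2)
    (hM : dJ M x y = (2 : ℝ) • dX L x y) : eulerLagrange flatSpray L x y = 0 := by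
  rw [eulerLagrange_flat_eq (isOpen_slit hUo) hL ⟨hx, hy⟩,
    dJ_congr_on (isOpen_slit hUo) (show (x, y) ∈ slit U from ⟨hx, hy⟩) hS, hM, sub_self]

theorem dJ_const_mul {L : E → E → ℝ} (a : ℝ)
    (hL : DifferentiableAt ℝ (fun p : E × E => L p.1 p.2) (x, y)) :
    dJ (fun x y => a * L x y) x y = a • dJ L x y :=
  fderiv_const_mul (differentiableAt_snd_slice hL) a

theorem dX_const_mul {L : E → E → ℝ} (a : ℝ)
    (hL : DifferentiableAt ℝ (fun p : E × E => L p.1 p.2) (x, y)) :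
    dX (fun x y => a * L x y) x y = a • dX L x y :=
  fderiv_const_mul (hL.comp (f := fun z => (z, y)) x (by fun_prop)) a

theorem smoothOn_projFactor (hU : ∀ x ∈ U, 4 * c ^ 2 * ‖x‖ ^ 2 < 1) :
    ContDiffOn ℝ ∞ (fun p : E × E => 2 * c * randers c p.1 p.2) (slit U) :=
  contDiffOn_const.mul (smoothOn_randers hU)

theorem dJ_self_of_smul (hUo : IsOpen U) {L : E → E → ℝ}
    (hL : ContDiffOn ℝ ∞ (fun p : E × E => L p.1 p.2) (slit U)) (hx : x ∈ U) (hy : y ≠ 0)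
    (hom : ∀ r : ℝ, 0 < r → L x (r • y) = r * L x y) : dJ L x y y = L x y := by
  simpa using dJ_self_of_homogeneous 1
    (differentiableAt_of_smoothOn (isOpen_slit hUo) hL ⟨hx, hy⟩)
    fun r hr => by simpa using hom r hr

theorem dX_projFactor (hUo : IsOpen U) (hU : ∀ x ∈ U, 4 * c ^ 2 * ‖x‖ ^ 2 < 1) (hx : x ∈ U)
    (hy : y ≠ 0) : dX (fun x y => 2 * c * randers c x y) x y =
      (2 * c * randers c x y) • dJ (fun x y => 2 * c * randers c x y) x y := by
  have dF := differentiableAt_of_smoothOn (isOpen_slit hUo) (smoothOn_randers hU)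
    (show (x, y) ∈ slit U from ⟨hx, hy⟩)
  rw [dX_const_mul _ dF, dJ_const_mul _ dF, dX_randers hUo hU hx hy]
  module

theorem eulerLagrange_projFactor (hUo : IsOpen U) (hU : ∀ x ∈ U, 4 * c ^ 2 * ‖x‖ ^ 2 < 1)
    (hx : x ∈ U) (hy : y ≠ 0) :
    eulerLagrange flatSpray (fun x y => 2 * c * randers c x y) x y = 0 := by
  have hO := isOpen_slit hUo
  have hP := smoothOn_projFactor hU
  have dP := differentiableAt_of_smoothOn (L := fun x y => 2 * c * randers c x y) hO hP
    (show (x, y) ∈ slit U from ⟨hx, hy⟩)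
  refine eulerLagrange_flat_eq_zero_of_dJ_eq (L := fun x y => 2 * c * randers c x y)
    -- `M = P²`, since `S₀P = P d_JP(y) = P²`; then `d_J(P²) = 2P d_JP = 2 d_{h₀}P`.
    (M := fun x y => 2 * c * randers c x y * (2 * c * randers c x y)) hUo hP hx hy
    (fun p hp => ?_) ?_
  · rw [sprayDeriv_flat_eq_dX (L := fun x y => 2 * c * randers c x y)
      (differentiableAt_of_smoothOn (L := fun x y => 2 * c * randers c x y) hO hP hp),
      dX_projFactor hUo hU hp.1 hp.2, smul_apply,
      dJ_self_of_smul (L := fun x y => 2 * c * randers c x y) hUo hP hp.1 hp.2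
        fun r hr => by rw [randers_smul c _ _ hr]; ring]
    rfl
  · rw [dJ_mul (A := fun x y => 2 * c * randers c x y) dP dP, dX_projFactor hUo hU hx hy]
    module

/-- Contract `d_{h₀}F̃ = 2c d_J(FF̃)` with `y`; the product `FF̃` is 2-homogeneous, so `2c` becomes
`4c`. -/
theorem sprayDeriv_flat_conformalFamily (hUo : IsOpen U) (hU : ∀ x ∈ U, 4 * c ^ 2 * ‖x‖ ^ 2 < 1)
    (hx : x ∈ U) (hy : y ≠ 0) : sprayDeriv flatSpray (conformalFamily c η e v) x y =
      4 * c * (randers c x y * conformalFamily c η e v x y) := by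
  have hL := smoothOn_conformalFamily hU η e v
  rw [sprayDeriv_flat_eq_dX (differentiableAt_of_smoothOn (isOpen_slit hUo) hL ⟨hx, hy⟩),
    dX_conformalFamily hUo hU hx hy]
  simp only [smul_apply, add_apply, smul_eq_mul,
    dJ_self_of_smul hUo hL hx hy fun r hr => conformalFamily_smul c η e v x y hr,
    dJ_self_of_smul hUo (smoothOn_randers hU) hx hy fun r hr => randers_smul c x y hr]
  ring

theorem eulerLagrange_conformalFamily (hUo : IsOpen U) (hU : ∀ x ∈ U, 4 * c ^ 2 * ‖x‖ ^ 2 < 1)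
    (hx : x ∈ U) (hy : y ≠ 0) :
    eulerLagrange flatSpray (conformalFamily c η e v) x y = 0 := by
  have hO := isOpen_slit hUo
  have h : (x, y) ∈ slit U := ⟨hx, hy⟩
  have hL := smoothOn_conformalFamily hU η e v
  have dF := differentiableAt_of_smoothOn hO (smoothOn_randers hU) h
  have dL := differentiableAt_of_smoothOn hO hL h
  refine eulerLagrange_flat_eq_zero_of_dJ_eq
    (M := fun x y => 4 * c * (randers c x y * conformalFamily c η e v x y)) hUo hL hx hy
    (fun p hp => sprayDeriv_flat_conformalFamily hUo hU hp.1 hp.2) ?_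
  rw [dJ_const_mul (L := fun x y => randers c x y * conformalFamily c η e v x y) _ (dF.mul dL),
    dJ_mul dF dL, dX_conformalFamily hUo hU hx hy]
  module

theorem isProjectivelyFlatWith_conformalFamily (hUo : IsOpen U)
    (hU : ∀ x ∈ U, 4 * c ^ 2 * ‖x‖ ^ 2 < 1)
    (hpre : IsPreFinslerOn U (conformalFamily c η e v)) :
    IsProjectivelyFlatWith U (conformalFamily c η e v) (fun x y => 2 * c * randers c x y) := by
  refine (hpre.isProjectivelyFlatWith_iff hUo (smoothOn_projFactor hU) fun x _ y _ r hr => ?_).2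
    fun x hx y hy => ⟨eulerLagrange_conformalFamily hUo hU hx hy, ?_⟩
  · rw [randers_smul c x y hr]
    ring
  · rw [sprayDeriv_flat_conformalFamily hUo hU hx hy]
    ring

theorem jacobiEndomorphism_projFactor (hUo : IsOpen U) (hU : ∀ x ∈ U, 4 * c ^ 2 * ‖x‖ ^ 2 < 1)
    (hx : x ∈ U) (hy : y ≠ 0) :
    jacobiEndomorphism (projSpray fun x y => 2 * c * randers c x y) x y = 0 :=
  jacobiEndomorphism_projSpray_eq_zero (P := fun x y => 2 * c * randers c x y) hUo
    (smoothOn_projFactor hU) (fun x _ y _ r hr => by rw [randers_smul c x y hr]; ring)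
    (fun _ hx _ hy => dX_projFactor hUo hU hx hy)
    (fun _ hx _ hy => eulerLagrange_projFactor hUo hU hx hy) hx hy

end Families

end FlatFinsler

end

/-! ### The criterion and the explicit family in Euclidean space. -/

theorem mainTheorem12 (n : ℕ) :
    -- the criterion for a deformation of projectively flat metrics to be projectively flat
    (∀ (U : Set (EuclideanSpace ℝ (Fin n)))
        (F Fbar : EuclideanSpace ℝ (Fin n) → EuclideanSpace ℝ (Fin n) → ℝ)
        (g : EuclideanSpace ℝ (Fin n) → ℝ)
        (f : EuclideanSpace ℝ (Fin n) → EuclideanSpace ℝ (Fin n) →L[ℝ] ℝ),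
      IsOpen U →
      FlatFinsler.IsFinslerOn U F → FlatFinsler.IsProjectivelyFlatOn U F →
      FlatFinsler.IsFinslerOn U Fbar → FlatFinsler.IsProjectivelyFlatOn U Fbar →
      ContDiffOn ℝ ∞ g U → ContDiffOn ℝ ∞ f U →
      -- the 1-form `f` is closed
      (∀ x ∈ U, ∀ u w, FlatFinsler.dOneForm f x u w = 0) →
      FlatFinsler.IsFinslerOn U (FlatFinsler.deformation F Fbar g f) →
      (FlatFinsler.IsProjectivelyFlatOn U (FlatFinsler.deformation F Fbar g f) ↔
        ∀ x ∈ U, ∀ y, y ≠ 0 → ∀ w, FlatFinsler.flatnessForm F Fbar g f x y w = 0)) ∧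
    -- the explicit family
    (∀ (U : Set (EuclideanSpace ℝ (Fin n))) (c η e : ℝ) (v : EuclideanSpace ℝ (Fin n)),
      IsOpen U → (∀ x ∈ U, 4 * c ^ 2 * ‖x‖ ^ 2 < 1) → 0 < η →
      (∀ x ∈ U, ∀ y, y ≠ 0 → 0 < FlatFinsler.conformalFamily c η e v x y) →
      -- the explicit form of the metric
      (∀ x ∈ U, ∀ y, y ≠ 0 →
        FlatFinsler.conformalFamily c η e v x y =
          η * (FlatFinsler.root c x y + 2 * c * inner ℝ x y) ^ 2 /
              ((1 - 4 * c ^ 2 * ‖x‖ ^ 2) ^ 2 * FlatFinsler.root c x y) *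
            (2 * c * inner ℝ v x + e +
              inner ℝ v y /
                (FlatFinsler.root c x y / (1 - 4 * c ^ 2 * ‖x‖ ^ 2) +
                  2 * c * inner ℝ x y / (1 - 4 * c ^ 2 * ‖x‖ ^ 2)))) ∧
      FlatFinsler.IsPreFinslerOn U (FlatFinsler.conformalFamily c η e v) ∧
      -- Hamel's equation
      (∀ x ∈ U, ∀ y, y ≠ 0 →
        FlatFinsler.eulerLagrange FlatFinsler.flatSpray
          (FlatFinsler.conformalFamily c η e v) x y = 0) ∧
      -- projective flatness, with projective factor `P = 2 c F`, a Hamel function of `S₀`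
      FlatFinsler.IsProjectivelyFlatWith U (FlatFinsler.conformalFamily c η e v)
        (fun x y => 2 * c * FlatFinsler.randers c x y) ∧
      (∀ x ∈ U, ∀ y, y ≠ 0 →
        FlatFinsler.sprayDeriv FlatFinsler.flatSpray (FlatFinsler.conformalFamily c η e v) x y /
            (2 * FlatFinsler.conformalFamily c η e v x y) =
          2 * c * FlatFinsler.randers c x y) ∧
      FlatFinsler.IsHamelOn U FlatFinsler.flatSpray
        (fun x y => 2 * c * FlatFinsler.randers c x y) ∧
      -- the Jacobi endomorphism of `S₀ - 2 P 𝒞` vanishes: zero flag curvature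
      (∀ x ∈ U, ∀ y, y ≠ 0 →
        FlatFinsler.jacobiEndomorphism
          (FlatFinsler.projSpray fun x y => 2 * c * FlatFinsler.randers c x y) x y = 0) ∧
      FlatFinsler.HasFlagCurvatureOn U (FlatFinsler.conformalFamily c η e v) (fun _ _ => 0) ∧
      -- where the metric tensor is nondegenerate, there is no other geodesic spray
      (∀ G, FlatFinsler.IsGeodesicSprayOn U (FlatFinsler.conformalFamily c η e v) G →
        ∀ x ∈ U, ∀ y, y ≠ 0 →
          (∀ u, (∀ w, FlatFinsler.metricTensor
            (FlatFinsler.conformalFamily c η e v) x y u w = 0) → u = 0) →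
          G x y = (2 * c * FlatFinsler.randers c x y) • y)) := by
  refine ⟨fun U F Fbar g f hU hF hFflat hFbar hFbarflat hg hf hclosed hdef =>
    FlatFinsler.isProjectivelyFlatOn_deformation_iff hU hF.toIsPreFinslerOn hFflat
      hFbar.toIsPreFinslerOn hFbarflat hg hf hclosed hdef.toIsPreFinslerOn, ?_⟩
  intro U c η e v hUo hU hη hpos
  have hpre := FlatFinsler.isPreFinslerOn_conformalFamily hUo hU hη hpos
  have hflat := FlatFinsler.isProjectivelyFlatWith_conformalFamily hUo hU hpre
  refine ⟨fun x hx y hy => ?_, hpre,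
    fun x hx y hy => FlatFinsler.eulerLagrange_conformalFamily hUo hU hx hy, hflat,
    fun x hx y hy => ?_,
    ⟨hflat.homogeneous, fun x hx y hy => FlatFinsler.eulerLagrange_projFactor hUo hU hx hy⟩,
    fun x hx y hy => FlatFinsler.jacobiEndomorphism_projFactor hUo hU hx hy,
    ⟨_, hflat.geodesic, fun x hx y hy w => ?_⟩,
    fun G hG x hx y hy hreg => hpre.eq_of_isGeodesicSprayOn hUo hG hflat.geodesic hx hy hreg⟩
  · rw [FlatFinsler.conformalFamily, FlatFinsler.deformation, FlatFinsler.berwald,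
      FlatFinsler.randers, innerSL_apply_apply]
    ring
  · rw [FlatFinsler.sprayDeriv_flat_conformalFamily hUo hU hx hy]
    have := (hpos x hx y hy).ne'
    field_simp
    ring
  · rw [FlatFinsler.jacobiEndomorphism_projFactor hUo hU hx hy]
    simp
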